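/- Consider the following five equations over $\mathbb{Q}$: \begin{align*} C_{28,1}\colon\ y^2 + (x^2 + x) y &= x^6 + 3 x^5 + 5 x^4 - 4 x^2 - 10 x + 4,\\ C_{28,2}\colon\ y^2 + (x^2 + x) y &= x^6 + 3 x^5 + 3 x^4 + 13 x^3 - 6 x^2 + 18 x,\\ C_{28,3}\colon\ y^2 + (x^2 + x) y &= 4 x^6 - 2 x^5 + 18 x^4 + 3 x^3 + 13 x^2 + 23 x - 11,\\ C_{28,4}\colon\ y^2 + (x^2 + x) y &= 28320768 x^6 + 167100960 x^5 + 213557586 x^4 - 35302844 x^3\\ &\qquad + 154134546 x^2 - 155174208 x + 40064896,\\ C_{28,5}\colon\ y^2 + (x^2 + x) y &= 25 x^6 - 455 x^5 + 1675 x^4 + 2494 x^3 + 570 x^2 - 1210 x. \end{align*} For each $i\in\{1,\dots,5\}$, the smooth projective curve over $\mathbb{Q}$ with affine equation $C_{28,i}$ is a geometrically irreducible curve of genus $2$, and its Jacobian has a rational torsion point of order exactly $28$, that is, the group $\operatorname{Jac}(C_{28,i})(\mathbb{Q})$ has an element of order $28$. -/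

import Mathlib

open Polynomial
open scoped WithZero

noncomputable section

/-! ## Algebraic curves over an algebraically closed field, through their function fields

`k` is an algebraically closed field and `F` a field of functions in one variable over `k`.  The
points of the smooth projective curve with function field `F` are the places of `F` over `k`. -/

section FunctionFields

variable (k F : Type*) [Field k] [CommRing F] [Algebra k F]

/-- A place of `F` over `k`: a normalized (that is, surjective onto `ℤ ∪ {∞}`, written
multiplicatively) discrete valuation of `F` that is trivial on `k`.  These are the closed points of
the smooth projective curve over `k` with function field `F`. -/
def Place : Type _ :=
  {v : Valuation F ℤᵐ⁰ // Function.Surjective v ∧ ∀ c : k, c ≠ 0 → v (algebraMap k F c) = 1}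

/-- Divisors: formal finite `ℤ`-linear combinations of places. -/
abbrev CurveDivisor : Type _ := Place k F →₀ ℤ

variable {k F}

/-- The order of vanishing of a nonzero function `u` at a place `P`. -/
def Place.ord (P : Place k F) (u : Fˣ) : ℤ := -WithZero.log (P.1 (u : F))

theorem Place.ord_one (P : Place k F) : P.ord 1 = 0 := by
  simp [Place.ord]

theorem Place.ord_mul (P : Place k F) (u w : Fˣ) : P.ord (u * w) = P.ord u + P.ord w := by
  have h (z : Fˣ) : P.1 (z : F) ≠ 0 := (z.isUnit.map P.1).ne_zero
  simp only [Place.ord, Units.val_mul, map_mul, WithZero.log_mul (h u) (h w)]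
  ring

theorem Place.ord_inv (P : Place k F) (u : Fˣ) : P.ord u⁻¹ = -P.ord u := by
  have h := P.ord_mul u u⁻¹
  rw [mul_inv_cancel, P.ord_one] at h
  linarith

variable (k F)

/-- The group of principal divisors `div u = ∑_P ord_P(u) P`, for `u` a nonzero function. -/
def principalDivisors : AddSubgroup (CurveDivisor k F) where
  carrier := {D | ∃ u : Fˣ, ∀ P : Place k F, D P = P.ord u}
  zero_mem' := ⟨1, fun P => by simp [P.ord_one]⟩
  add_mem' := by
    rintro D E ⟨u, hu⟩ ⟨w, hw⟩
    exact ⟨u * w, fun P => by rw [P.ord_mul, Finsupp.add_apply, hu, hw]⟩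
  neg_mem' := by
    rintro D ⟨u, hu⟩
    exact ⟨u⁻¹, fun P => by rw [P.ord_inv, Finsupp.neg_apply, hu]⟩

/-- The degree of a divisor (all places have degree `1`, because `k` is algebraically closed). -/
def divisorDegree : CurveDivisor k F →+ ℤ := Finsupp.liftAddHom fun _ => AddMonoidHom.id ℤ

/-- The divisor class group. -/
abbrev DivisorClassGroup : Type _ := CurveDivisor k F ⧸ principalDivisors k F

/-- The group `Pic⁰` of divisor classes of degree `0`. -/
def picZero : AddSubgroup (DivisorClassGroup k F) :=
  (divisorDegree k F).ker.map (QuotientAddGroup.mk' (principalDivisors k F))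

/-- The `k`-vector space of regular (everywhere holomorphic) differentials: those
`ω ∈ Ω_{F/k}` which at every place `P`, with valuation ring `𝒪_P`, can be written as a finite sum
`∑ aᵢ dbᵢ` with `aᵢ, bᵢ ∈ 𝒪_P`. -/
def regularDifferentials : Submodule k Ω[F⁄k] where
  carrier := {ω | ∀ P : Place k F, ω ∈ Submodule.span P.1.integer
    (Set.range fun b : P.1.integer => KaehlerDifferential.D k F (b : F))}
  zero_mem' := fun _ => Submodule.zero_mem _
  add_mem' := fun h₁ h₂ P => Submodule.add_mem _ (h₁ P) (h₂ P)
  smul_mem' := by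
    intro c ω hω P
    have hc : algebraMap k F c ∈ P.1.integer := by
      rw [Valuation.mem_integer_iff]
      by_cases h : c = 0
      · simp [h]
      · exact (P.2.2 c h).le
    have h := Submodule.smul_mem _ (⟨algebraMap k F c, hc⟩ : P.1.integer) (hω P)
    have e : (⟨algebraMap k F c, hc⟩ : P.1.integer) • ω = c • ω := by
      rw [← algebraMap_smul F (⟨algebraMap k F c, hc⟩ : P.1.integer) ω, ← algebraMap_smul F c ω]
      rfl
    rwa [e] at h

/-- The genus: the dimension of the space of regular differentials. -/
def curveGenus : ℕ := Module.finrank k (regularDifferentials k F)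

variable {k F}

/-- The place `e(P)`, for an automorphism `e` of `F` that extends an automorphism `σ` of `k`:
its valuation is `ord_{e(P)}(u) = ord_P (e⁻¹ u)`. -/
def Place.map (σ : k ≃+* k) (e : F ≃+* F)
    (h : ∀ c, e (algebraMap k F c) = algebraMap k F (σ c)) (P : Place k F) : Place k F :=
  ⟨P.1.comap (e.symm : F →+* F), by
    refine ⟨P.2.1.comp e.symm.surjective, fun c hc => ?_⟩
    have hs : e.symm (algebraMap k F c) = algebraMap k F (σ.symm c) := by
      rw [RingEquiv.symm_apply_eq, h, RingEquiv.apply_symm_apply]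
    have := P.2.2 (σ.symm c) (by simpa using hc)
    simpa [Valuation.comap_apply, hs] using this⟩

theorem Place.map_symm_map (σ : k ≃+* k) (e : F ≃+* F)
    (h : ∀ c, e (algebraMap k F c) = algebraMap k F (σ c))
    (h' : ∀ c, e.symm (algebraMap k F c) = algebraMap k F (σ.symm c)) (P : Place k F) :
    Place.map σ.symm e.symm h' (Place.map σ e h P) = P := by
  apply Subtype.ext
  ext u
  simp [Place.map, Valuation.comap_apply]

theorem Place.map_map_symm (σ : k ≃+* k) (e : F ≃+* F)
    (h : ∀ c, e (algebraMap k F c) = algebraMap k F (σ c))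
    (h' : ∀ c, e.symm (algebraMap k F c) = algebraMap k F (σ.symm c)) (P : Place k F) :
    Place.map σ e h (Place.map σ.symm e.symm h' P) = P := by
  apply Subtype.ext
  ext u
  simp [Place.map, Valuation.comap_apply]

theorem Place.ord_map (σ : k ≃+* k) (e : F ≃+* F)
    (h : ∀ c, e (algebraMap k F c) = algebraMap k F (σ c)) (P : Place k F) (u : Fˣ) :
    (P.map σ e h).ord (Units.map (e : F →* F) u) = P.ord u := by
  simp [Place.map, Place.ord, Valuation.comap_apply]

/-- The action of such an automorphism on divisors: `∑ n_P P ↦ ∑ n_P e(P)`. -/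
def divisorMap (σ : k ≃+* k) (e : F ≃+* F)
    (h : ∀ c, e (algebraMap k F c) = algebraMap k F (σ c)) :
    CurveDivisor k F →+ CurveDivisor k F :=
  Finsupp.mapDomain.addMonoidHom (Place.map σ e h)

theorem divisorMap_mem_principalDivisors (σ : k ≃+* k) (e : F ≃+* F)
    (h : ∀ c, e (algebraMap k F c) = algebraMap k F (σ c)) :
    principalDivisors k F ≤ (principalDivisors k F).comap (divisorMap σ e h) := by
  rintro D ⟨u, hu⟩
  have h' : ∀ c, e.symm (algebraMap k F c) = algebraMap k F (σ.symm c) := fun c => by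
    rw [RingEquiv.symm_apply_eq, h, RingEquiv.apply_symm_apply]
  refine ⟨Units.map (e : F →* F) u, fun P => ?_⟩
  obtain ⟨Q, rfl⟩ : ∃ Q, Place.map σ e h Q = P := ⟨_, Place.map_map_symm σ e h h' P⟩
  have hinj : Function.Injective (Place.map σ e h) :=
    Function.LeftInverse.injective (Place.map_symm_map σ e h h')
  rw [Place.ord_map, ← hu]
  exact Finsupp.mapDomain_apply hinj D Q

/-- The induced action on divisor classes. -/
def divisorClassMap (σ : k ≃+* k) (e : F ≃+* F)
    (h : ∀ c, e (algebraMap k F c) = algebraMap k F (σ c)) :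
    DivisorClassGroup k F →+ DivisorClassGroup k F :=
  QuotientAddGroup.map _ _ (divisorMap σ e h) (divisorMap_mem_principalDivisors σ e h)

end FunctionFields

/-! ## Curves `y² + h(x) y = f(x)` over `ℚ` -/

/-- An equation `y² + h(x) y = f(x)` with rational coefficients.  It stands for the smooth
projective curve over `ℚ` birational to the affine plane curve with this equation. -/
structure HyperellipticEquation where
  h : ℚ[X]
  f : ℚ[X]

namespace HyperellipticEquation

/-- The algebraic closure of `ℚ`. -/
abbrev Qbar : Type := AlgebraicClosure ℚ

/-- A polynomial with rational coefficients as a rational function over `Qbar`. -/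
def toRatFunc (p : ℚ[X]) : RatFunc Qbar :=
  algebraMap Qbar[X] (RatFunc Qbar) (p.map (algebraMap ℚ Qbar))

variable (C : HyperellipticEquation)

/-- The polynomial `Y² + h(x) Y - f(x)` in `Y` over `Qbar(x)`. -/
def poly : (RatFunc Qbar)[X] :=
  X ^ 2 + Polynomial.C (toRatFunc C.h) * X - Polynomial.C (toRatFunc C.f)

/-- The function field `Qbar(x)[y] / (y² + h(x) y - f(x))` of the curve over `Qbar`. -/
abbrev FunctionField : Type := AdjoinRoot C.poly

/-- The action of `σ ∈ Gal(Qbar/ℚ)` on the coefficients of rational functions in `x`. -/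
def galoisRatFunc (σ : Qbar ≃ₐ[ℚ] Qbar) : RatFunc Qbar ≃+* RatFunc Qbar :=
  IsFractionRing.ringEquivOfRingEquiv (Polynomial.mapEquiv σ.toRingEquiv)

theorem galoisRatFunc_algebraMap (σ : Qbar ≃ₐ[ℚ] Qbar) (p : Qbar[X]) :
    galoisRatFunc σ (algebraMap Qbar[X] (RatFunc Qbar) p) =
      algebraMap Qbar[X] (RatFunc Qbar) (p.map (σ : Qbar →+* Qbar)) := by
  simp only [galoisRatFunc, IsFractionRing.ringEquivOfRingEquiv_algebraMap]
  rfl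

theorem galoisRatFunc_toRatFunc (σ : Qbar ≃ₐ[ℚ] Qbar) (p : ℚ[X]) :
    galoisRatFunc σ (toRatFunc p) = toRatFunc p := by
  rw [toRatFunc, galoisRatFunc_algebraMap, Polynomial.map_map]
  congr 2
  exact σ.toAlgHom.comp_algebraMap

theorem poly_map (σ : Qbar ≃ₐ[ℚ] Qbar) :
    C.poly.map (galoisRatFunc σ : RatFunc Qbar →+* RatFunc Qbar) = C.poly := by
  simp [poly, galoisRatFunc_toRatFunc]

/-- The action of `σ ∈ Gal(Qbar/ℚ)` on the function field over `Qbar`: it acts on coefficients,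
and fixes `x` and `y`. -/
def galoisFunctionField (σ : Qbar ≃ₐ[ℚ] Qbar) : C.FunctionField ≃+* C.FunctionField :=
  AdjoinRoot.mapRingEquiv (galoisRatFunc σ) C.poly C.poly
    (by rw [C.poly_map σ])

theorem galoisFunctionField_root (σ : Qbar ≃ₐ[ℚ] Qbar) :
    C.galoisFunctionField σ (AdjoinRoot.root C.poly) = AdjoinRoot.root C.poly := by
  simp [galoisFunctionField]

theorem galoisFunctionField_algebraMap (σ : Qbar ≃ₐ[ℚ] Qbar) (c : Qbar) :
    C.galoisFunctionField σ (algebraMap Qbar C.FunctionField c) =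
      algebraMap Qbar C.FunctionField (σ.toRingEquiv c) := by
  have h (c : Qbar) : algebraMap Qbar C.FunctionField c =
      AdjoinRoot.of C.poly (algebraMap Qbar[X] (RatFunc Qbar) (Polynomial.C c)) := rfl
  rw [h, h, galoisFunctionField, AdjoinRoot.coe_mapRingEquiv, AdjoinRoot.map_of]
  congr 1
  exact (galoisRatFunc_algebraMap σ _).trans (by simp)

/-- The Galois action on divisor classes of the curve over `Qbar`. -/
def galoisClass (σ : Qbar ≃ₐ[ℚ] Qbar) :
    DivisorClassGroup Qbar C.FunctionField →+ DivisorClassGroup Qbar C.FunctionField :=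
  divisorClassMap σ.toRingEquiv (C.galoisFunctionField σ) (C.galoisFunctionField_algebraMap σ)

/-- The equation defines a geometrically irreducible curve: its function field over `Qbar` is
a field. -/
def IsGeometricallyIrreducible : Prop := IsField C.FunctionField

/-- The genus of the curve. -/
def genus : ℕ := curveGenus Qbar C.FunctionField

/-- The group `J(ℚ)` of rational points of the Jacobian `J` of the curve: the divisor classes of
degree `0` over `Qbar` that are fixed by `Gal(Qbar/ℚ)`. -/
def jacobianRationalPoints : AddSubgroup (DivisorClassGroup Qbar C.FunctionField) where
  carrier := {c | c ∈ picZero Qbar C.FunctionField ∧ ∀ σ : Qbar ≃ₐ[ℚ] Qbar, C.galoisClass σ c = c}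
  zero_mem' := ⟨zero_mem _, fun σ => map_zero _⟩
  add_mem' := fun ha hb => ⟨add_mem ha.1 hb.1, fun σ => by rw [map_add, ha.2 σ, hb.2 σ]⟩
  neg_mem' := fun ha => ⟨neg_mem ha.1, fun σ => by rw [map_neg, ha.2 σ]⟩

end HyperellipticEquation

/-- The curve `C_{28,1}`. -/
def C28_1 : HyperellipticEquation where
  h := X ^ 2 + X
  f := X ^ 6 + 3 * X ^ 5 + 5 * X ^ 4 - 4 * X ^ 2 - 10 * X + 4

/-- The curve `C_{28,2}`. -/
def C28_2 : HyperellipticEquation where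
  h := X ^ 2 + X
  f := X ^ 6 + 3 * X ^ 5 + 3 * X ^ 4 + 13 * X ^ 3 - 6 * X ^ 2 + 18 * X

/-- The curve `C_{28,3}`. -/
def C28_3 : HyperellipticEquation where
  h := X ^ 2 + X
  f := 4 * X ^ 6 - 2 * X ^ 5 + 18 * X ^ 4 + 3 * X ^ 3 + 13 * X ^ 2 + 23 * X - 11

/-- The curve `C_{28,4}`. -/
def C28_4 : HyperellipticEquation where
  h := X ^ 2 + X
  f := 28320768 * X ^ 6 + 167100960 * X ^ 5 + 213557586 * X ^ 4 - 35302844 * X ^ 3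
    + 154134546 * X ^ 2 - 155174208 * X + 40064896

/-- The curve `C_{28,5}`. -/
def C28_5 : HyperellipticEquation where
  h := X ^ 2 + X
  f := 25 * X ^ 6 - 455 * X ^ 5 + 1675 * X ^ 4 + 2494 * X ^ 3 + 570 * X ^ 2 - 1210 * X

end

/-! Completing the square with Y = 2y + h turns y² + hy = f into Y² = g(x), where g = h² + 4f. In
all five cases g is a sextic with a simple rational root w. A simple root prevents g from being a
square, which gives irreducibility over Qbar(x) (`irreducible_poly`). With u = 1/(x - w) and V =
Y/(x - w)³ the equation becomes V² = G(u) for a separable quintic G. This affine curve misses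
exactly one place, the Weierstrass point over w, where u and V have poles of order 2 and 5.

Places are abstract valuations, so a dictionary with points is needed. At a nonsingular point every
nonzero function is a power of a uniformizer times a unit (`exists_zpow_mul`). Hence there is
exactly one place over such a point (`exists_isAt`, `IsAt.unique`), and over an algebraically closed
field every place where x is finite lies over a point (`exists_isAt_of_map_le_one`).

A function with no pole outside infinity is A(u) + B(u)V. Its two terms have pole orders 2 deg A and
2 deg B + 5, of different parity, so they cannot cancel (`exists_polyFn_of_pole_le`). This has two
uses. Regular differentials are φ du/V with φ of pole order at most 2 at infinity, so φ = a + bu and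
the genus is 2. And if mD is principal with m deg a ≤ 4, where D has Mumford pair (a, b), the
function is a polynomial in u alone; it cannot vanish at (r, b(r)) without vanishing at (r, -b(r)),
which D avoids. So D and 2D are not principal.

In the other direction, a function A + BV of norm c·aⁿ that vanishes on D but not on its conjugate
has divisor nD (`nsmul_mumfordDivisor_mem_principalDivisors`). Such functions are given explicitly
for a D with n = 4 and another with n = 7. The classes then have orders exactly 4 and 7. They are
Galois invariant because a, b and w are rational, and their sum has order 28. -/

noncomputable section

/-! ## Affine charts `y² = g(x)` of a function field -/

section Chart

open IntermediateField

variable {K F : Type} [Field K] [Field F] [Algebra K F]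

/-- `F` is the function field of the affine curve `y² = g(x)` over `K`. -/
structure IsChart (g : K[X]) (x y : F) : Prop where
  transcendental : Transcendental K x
  sq : y ^ 2 = aeval x g
  not_mem : y ∉ K⟮x⟯
  gen : ∀ z : F, ∃ a ∈ K⟮x⟯, ∃ b ∈ K⟮x⟯, z = a + b * y

/-- The function `A(x) + B(x) y`. -/
def polyFn (x y : F) (A B : K[X]) : F := aeval x A + aeval x B * y

/-- The value of `A(x) + B(x) y` at the point `(r, s)`. -/
def polyVal (r s : K) (A B : K[X]) : K := A.eval r + B.eval r * s

/-- `(r, s)` is a nonsingular point of the affine curve `y² = g(x)`. -/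
structure IsPoint (g : K[X]) (r s : K) : Prop where
  sq : s ^ 2 = g.eval r
  nonsing : s ≠ 0 ∨ g.derivative.eval r ≠ 0

theorem polyFn_zero_right (x y : F) (A : K[X]) : polyFn x y A 0 = aeval x A := by
  simp [polyFn]

theorem polyVal_mul {g : K[X]} {r s : K} (hP : s ^ 2 = g.eval r) (A B A' B' : K[X]) :
    polyVal r s (A * A' + B * B' * g) (A * B' + A' * B) =
      polyVal r s A B * polyVal r s A' B' := by
  simp only [polyVal, eval_add, eval_mul, ← hP]
  ring

theorem polyFn_add (x y : F) (A B A' B' : K[X]) :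
    polyFn x y (A + A') (B + B') = polyFn x y A B + polyFn x y A' B' := by
  simp only [polyFn, map_add]
  ring

namespace IsChart

variable {g : K[X]} {x y : F}

theorem aeval_ne_zero (h : IsChart g x y) {p : K[X]} (hp : p ≠ 0) : aeval x p ≠ 0 :=
  fun h0 => hp ((transcendental_iff.1 h.transcendental) p h0)

theorem polyFn_mul (h : IsChart g x y) (A B A' B' : K[X]) :
    polyFn x y (A * A' + B * B' * g) (A * B' + A' * B) = polyFn x y A B * polyFn x y A' B' := by
  simp only [polyFn, map_add, map_mul, ← h.sq]
  ring

/-- The norm to K(x), taken along the hyperelliptic involution y ↦ -y. -/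
theorem polyFn_mul_conj (h : IsChart g x y) (A B : K[X]) :
    polyFn x y A B * polyFn x y A (-B) = aeval x (A ^ 2 - B ^ 2 * g) := by
  simp only [polyFn, map_sub, map_mul, map_pow, map_neg, ← h.sq]
  ring

/-- Otherwise y = -A(x)/B(x) would lie in K(x). Coefficients can therefore be compared in identities
between functions. -/
theorem polyFn_eq_zero (h : IsChart g x y) {A B : K[X]} (h0 : polyFn x y A B = 0) :
    A = 0 ∧ B = 0 := by
  have hB : B = 0 := by
    by_contra hB
    apply h.not_mem
    have hB' := h.aeval_ne_zero hB
    rw [mem_adjoin_simple_iff]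
    refine ⟨-A, B, ?_⟩
    rw [eq_div_iff hB', map_neg]
    unfold polyFn at h0
    linear_combination h0
  subst hB
  rw [polyFn_zero_right] at h0
  exact ⟨(transcendental_iff.1 h.transcendental) A h0, rfl⟩

theorem polyFn_inj (h : IsChart g x y) {A B A' B' : K[X]}
    (h0 : polyFn x y A B = polyFn x y A' B') : A = A' ∧ B = B' := by
  have : polyFn x y (A - A') (B - B') = 0 := by
    simp only [polyFn, map_sub] at h0 ⊢
    linear_combination h0
  obtain ⟨h1, h2⟩ := h.polyFn_eq_zero this
  exact ⟨sub_eq_zero.1 h1, sub_eq_zero.1 h2⟩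

theorem polyFn_ne_zero (h : IsChart g x y) {A B : K[X]} {r s : K} (h0 : polyVal r s A B ≠ 0) :
    polyFn x y A B ≠ 0 := by
  intro h1
  obtain ⟨rfl, rfl⟩ := h.polyFn_eq_zero h1
  simp [polyVal] at h0

theorem norm_ne_zero (h : IsChart g x y) {A B : K[X]} (h0 : polyFn x y A B ≠ 0) :
    A ^ 2 - B ^ 2 * g ≠ 0 := by
  intro h1
  have h2 := h.polyFn_mul_conj A B
  rw [h1, map_zero, mul_eq_zero] at h2
  rcases h2 with h2 | h2
  · exact h0 h2
  · obtain ⟨rfl, hB⟩ := h.polyFn_eq_zero h2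
    rw [neg_eq_zero] at hB
    subst hB
    simp [polyFn] at h0

theorem exists_polyFn (h : IsChart g x y) (z : F) :
    ∃ A B C : K[X], C ≠ 0 ∧ z * aeval x C = polyFn x y A B := by
  obtain ⟨a, ha, b, hb, rfl⟩ := h.gen z
  rw [mem_adjoin_simple_iff] at ha hb
  obtain ⟨a1, a2, rfl⟩ := ha
  obtain ⟨b1, b2, rfl⟩ := hb
  -- The fractions describing K(x) may have denominator 0, in which case their value is 0; these
  -- cases are treated apart.
  by_cases ha2 : a2 = 0
  · by_cases hb2 : b2 = 0
    · exact ⟨0, 0, 1, one_ne_zero, by simp [ha2, hb2, polyFn]⟩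
    · have := h.aeval_ne_zero hb2
      exact ⟨0, b1, b2, hb2, by simp [ha2, polyFn]; field_simp⟩
  · have ha2' := h.aeval_ne_zero ha2
    by_cases hb2 : b2 = 0
    · exact ⟨a1, 0, a2, ha2, by simp [hb2, polyFn]; field_simp⟩
    · have := h.aeval_ne_zero hb2
      exact ⟨a1 * b2, b1 * a2, a2 * b2, mul_ne_zero ha2 hb2, by simp [polyFn]; field_simp⟩

/-! ### The local ring at a nonsingular point: factorization into uniformizer power and unit -/

/-- Local uniformizer at the point `(r, s)`. -/
def uniformizer (x y : F) (r s : K) : F := by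
  classical exact if s = 0 then y else x - algebraMap K F r

theorem exists_eq_X_sub_C_mul {A : K[X]} {r : K} (h : A.eval r = 0) :
    ∃ A', A = (X - Polynomial.C r) * A' := dvd_iff_isRoot.2 h

/-- Extracting a uniformizer from A + By lowers the multiplicity of r in the norm A² - B²g, so the
extraction ends; k bounds that multiplicity strictly. -/
theorem exists_factor_aux [CharZero K] (h : IsChart g x y) {r s : K} (hP : IsPoint g r s)
    (k : ℕ) : ∀ A B : K[X], ¬ (X - Polynomial.C r) ^ k ∣ A ^ 2 - B ^ 2 * g →
    ∃ (n : ℕ) (A' B' C' D' : K[X]), polyVal r s A' B' ≠ 0 ∧ polyVal r s C' D' ≠ 0 ∧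
      polyFn x y A B * polyFn x y C' D' = uniformizer x y r s ^ n * polyFn x y A' B' := by
  induction k with
  | zero => intro A B hk; simp at hk
  | succ k ih =>
    intro A B hk
    by_cases h0 : polyVal r s A B = 0
    swap
    · exact ⟨0, A, B, 1, 0, h0, by simp [polyVal], by simp [polyFn]⟩
    by_cases hs : s = 0
    · subst hs
      have hπ : uniformizer x y r 0 = y := by simp [uniformizer]
      have hA : A.eval r = 0 := by simpa [polyVal] using h0
      have hg : g.eval r = 0 := by rw [← hP.sq]; simp
      obtain ⟨A1, rfl⟩ := exists_eq_X_sub_C_mul hA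
      obtain ⟨g1, hg1⟩ := exists_eq_X_sub_C_mul hg
      have hg1r : g1.eval r ≠ 0 := by
        have := hP.nonsing
        simpa [hg1] using this
      -- At a Weierstrass point g = (x - r)g₁ with g₁(r) ≠ 0. If A = (x - r)A₁, then g₁(A + By) =
      -- y(Bg₁ + A₁y), so one factor y comes out at the cost of the unit g₁.
      obtain ⟨n, A', B', C', D', h1, h2, h3⟩ := ih (B * g1) A1 (by
        intro hd
        apply hk
        have h4 : (X - Polynomial.C r) ^ (k + 1) ∣
            (((X - Polynomial.C r) * A1) ^ 2 - B ^ 2 * g) * g1 := by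
          have : (((X - Polynomial.C r) * A1) ^ 2 - B ^ 2 * g) * g1 =
            (X - Polynomial.C r) * -((B * g1) ^ 2 - A1 ^ 2 * g) := by rw [hg1]; ring
          rw [this, pow_succ']
          exact mul_dvd_mul_left _ (dvd_neg.2 hd)
        refine (IsCoprime.pow_left ?_).dvd_of_dvd_mul_right h4
        exact (irreducible_X_sub_C r).coprime_iff_not_dvd.2 (fun h5 => hg1r (dvd_iff_isRoot.1 h5)))
      refine ⟨n + 1, A', B', C' * g1, D' * g1, h1, ?_, ?_⟩
      · have : polyVal r 0 (C' * g1) (D' * g1) = polyVal r 0 C' D' * g1.eval r := by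
          simp [polyVal]
        rw [this]
        exact mul_ne_zero h2 hg1r
      · have e1 : polyFn x y ((X - Polynomial.C r) * A1) B * aeval x g1 =
            y * polyFn x y (B * g1) A1 := by
          have := h.sq
          rw [hg1] at this
          simp only [polyFn, map_mul] at this ⊢
          linear_combination -aeval x A1 * this
        have e2 : polyFn x y (C' * g1) (D' * g1) = aeval x g1 * polyFn x y C' D' := by
          simp only [polyFn, map_mul]; ring
        rw [e2, ← mul_assoc, e1, mul_assoc, h3, hπ]
        ring
    · have hπ : uniformizer x y r s = aeval x (X - Polynomial.C r) := by
        simp [uniformizer, hs]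
      -- Away from Weierstrass points: if the conjugate vanishes too, x - r divides both A and B. If
      -- not, the conjugate is a unit and the order can be read off the norm.
      by_cases h1 : polyVal r s A (-B) = 0
      · have h2 : A.eval r = 0 := by
          simp only [polyVal, eval_neg] at h0 h1
          have : (2 : K) * A.eval r = 0 := by linear_combination h0 + h1
          simpa using this
        have h3 : B.eval r = 0 := by
          simpa [polyVal, h2, hs] using h0
        obtain ⟨A1, rfl⟩ := exists_eq_X_sub_C_mul h2
        obtain ⟨B1, rfl⟩ := exists_eq_X_sub_C_mul h3
        obtain ⟨n, A', B', C', D', h1, h2, h3⟩ := ih A1 B1 (by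
          intro hd
          apply hk
          have : ((X - Polynomial.C r) * A1) ^ 2 - ((X - Polynomial.C r) * B1) ^ 2 * g =
            (X - Polynomial.C r) * ((X - Polynomial.C r) * (A1 ^ 2 - B1 ^ 2 * g)) := by ring
          rw [this, pow_succ']
          exact mul_dvd_mul_left _ (hd.mul_left _))
        refine ⟨n + 1, A', B', C', D', h1, h2, ?_⟩
        have e1 : polyFn x y ((X - Polynomial.C r) * A1) ((X - Polynomial.C r) * B1) =
            aeval x (X - Polynomial.C r) * polyFn x y A1 B1 := by
          simp only [polyFn, map_mul]; ring
        rw [e1, mul_assoc, h3, hπ]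
        ring
      · have hN : A ^ 2 - B ^ 2 * g ≠ 0 := fun h2 => hk (by simp [h2])
        obtain ⟨N, hN1, hN2⟩ := exists_eq_pow_rootMultiplicity_mul_and_not_dvd _ hN r
        refine ⟨rootMultiplicity r (A ^ 2 - B ^ 2 * g), N, 0, A, -B, ?_, h1, ?_⟩
        · simp only [polyVal, eval_zero, zero_mul, add_zero]
          exact fun h5 => hN2 (dvd_iff_isRoot.2 h5)
        · rw [h.polyFn_mul_conj, polyFn_zero_right, hπ, ← map_pow, ← map_mul, ← hN1]

theorem exists_factor [CharZero K] (h : IsChart g x y) {r s : K} (hP : IsPoint g r s)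
    {A B : K[X]} (h0 : polyFn x y A B ≠ 0) :
    ∃ (n : ℕ) (A' B' C' D' : K[X]), polyVal r s A' B' ≠ 0 ∧ polyVal r s C' D' ≠ 0 ∧
      polyFn x y A B * polyFn x y C' D' = uniformizer x y r s ^ n * polyFn x y A' B' := by
  refine h.exists_factor_aux hP (rootMultiplicity r (A ^ 2 - B ^ 2 * g) + 1) A B fun hd => ?_
  have := (le_rootMultiplicity_iff (h.norm_ne_zero h0)).2 hd
  omega

/-- `z` is regular at `(r, s)`. -/
def RegularAt (x y : F) (r s : K) (z : F) : Prop :=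
  ∃ A B C D : K[X], polyVal r s C D ≠ 0 ∧ z * polyFn x y C D = polyFn x y A B

/-- `z` is regular and nonzero at `(r, s)`. -/
def UnitAt (x y : F) (r s : K) (z : F) : Prop :=
  ∃ A B C D : K[X], polyVal r s A B ≠ 0 ∧ polyVal r s C D ≠ 0 ∧
    z * polyFn x y C D = polyFn x y A B

theorem UnitAt.regularAt {r s : K} {z : F} (h : UnitAt x y r s z) : RegularAt x y r s z := by
  obtain ⟨A, B, C, D, -, h2, h3⟩ := h
  exact ⟨A, B, C, D, h2, h3⟩

theorem unitAt_one (r s : K) : UnitAt x y r s 1 :=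
  ⟨1, 0, 1, 0, by simp [polyVal], by simp [polyVal], by simp⟩

theorem unitAt_polyFn {r s : K} {A B : K[X]} (h : polyVal r s A B ≠ 0) :
    UnitAt x y r s (polyFn x y A B) :=
  ⟨A, B, 1, 0, h, by simp [polyVal], by simp [polyFn]⟩

theorem regularAt_polyFn {r s : K} {A B : K[X]} : RegularAt x y r s (polyFn x y A B) :=
  ⟨A, B, 1, 0, by simp [polyVal], by simp [polyFn]⟩

theorem UnitAt.ne_zero (h : IsChart g x y) {r s : K} {z : F} (hz : UnitAt x y r s z) : z ≠ 0 := by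
  obtain ⟨A, B, C, D, h1, h2, h3⟩ := hz
  rintro rfl
  rw [zero_mul] at h3
  exact h.polyFn_ne_zero h1 h3.symm

theorem UnitAt.mul (h : IsChart g x y) {r s : K} (hP : IsPoint g r s) {z w : F}
    (hz : UnitAt x y r s z) (hw : UnitAt x y r s w) : UnitAt x y r s (z * w) := by
  obtain ⟨A, B, C, D, h1, h2, h3⟩ := hz
  obtain ⟨A', B', C', D', h1', h2', h3'⟩ := hw
  refine ⟨_, _, _, _, (polyVal_mul hP.sq A B A' B').symm ▸ mul_ne_zero h1 h1',
    (polyVal_mul hP.sq C D C' D').symm ▸ mul_ne_zero h2 h2', ?_⟩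
  rw [h.polyFn_mul, h.polyFn_mul, ← h3, ← h3']
  ring

theorem UnitAt.inv (h : IsChart g x y) {r s : K} {z : F}
    (hz : UnitAt x y r s z) : UnitAt x y r s z⁻¹ := by
  have h0 := hz.ne_zero h
  obtain ⟨A, B, C, D, h1, h2, h3⟩ := hz
  refine ⟨C, D, A, B, h2, h1, ?_⟩
  rw [← h3]
  field_simp

theorem RegularAt.mul (h : IsChart g x y) {r s : K} (hP : IsPoint g r s) {z w : F}
    (hz : RegularAt x y r s z) (hw : RegularAt x y r s w) : RegularAt x y r s (z * w) := by
  obtain ⟨A, B, C, D, h2, h3⟩ := hz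
  obtain ⟨A', B', C', D', h2', h3'⟩ := hw
  refine ⟨_, _, _, _, (polyVal_mul hP.sq C D C' D').symm ▸ mul_ne_zero h2 h2',
    (?_ : _ = polyFn x y (A * A' + B * B' * g) (A * B' + A' * B))⟩
  rw [h.polyFn_mul, h.polyFn_mul, ← h3, ← h3']
  ring

theorem RegularAt.add (h : IsChart g x y) {r s : K} (hP : IsPoint g r s) {z w : F}
    (hz : RegularAt x y r s z) (hw : RegularAt x y r s w) : RegularAt x y r s (z + w) := by
  obtain ⟨A, B, C, D, h2, h3⟩ := hz
  obtain ⟨A', B', C', D', h2', h3'⟩ := hw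
  refine ⟨_, _, _, _, (polyVal_mul hP.sq C D C' D').symm ▸ mul_ne_zero h2 h2',
    (?_ : _ = polyFn x y ((A * C' + B * D' * g) + (A' * C + B' * D * g))
      ((A * D' + C' * B) + (A' * D + C * B')))⟩
  rw [h.polyFn_mul, polyFn_add, h.polyFn_mul, h.polyFn_mul, ← h3, ← h3']
  ring

theorem regularAt_uniformizer (r s : K) : RegularAt x y r s (uniformizer x y r s) := by
  unfold uniformizer
  split_ifs
  · have : y = polyFn x y (0 : K[X]) 1 := by simp [polyFn]
    rw [this]
    exact ⟨0, 1, 1, 0, by simp [polyVal], by simp [polyFn]⟩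
  · exact ⟨X - Polynomial.C r, 0, 1, 0, by simp [polyVal], by simp [polyFn]⟩

theorem exists_uniformizer_eq (r s : K) :
    ∃ A B : K[X], polyVal r s A B = 0 ∧ uniformizer x y r s = polyFn x y A B := by
  unfold uniformizer
  split_ifs with hs
  · exact ⟨0, 1, by simp [polyVal, hs], by simp [polyFn]⟩
  · exact ⟨X - Polynomial.C r, 0, by simp [polyVal], by simp [polyFn]⟩

theorem uniformizer_ne_zero (h : IsChart g x y) (r s : K) : uniformizer x y r s ≠ 0 := by
  unfold uniformizer
  split_ifs with hs
  · intro hy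
    exact h.not_mem (hy ▸ zero_mem _)
  · have := h.aeval_ne_zero (X_sub_C_ne_zero r)
    simpa using this

theorem RegularAt.pow (h : IsChart g x y) {r s : K} (hP : IsPoint g r s) {z : F}
    (hz : RegularAt x y r s z) (n : ℕ) : RegularAt x y r s (z ^ n) := by
  induction n with
  | zero => simpa using (unitAt_one r s).regularAt
  | succ n ih => rw [pow_succ]; exact ih.mul h hP hz

theorem RegularAt.exists_pow_mul [CharZero K] (h : IsChart g x y) {r s : K} (hP : IsPoint g r s)
    {z : F} (hz : RegularAt x y r s z) (h0 : z ≠ 0) :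
    ∃ (n : ℕ) (u : F), UnitAt x y r s u ∧ z = uniformizer x y r s ^ n * u := by
  obtain ⟨A, B, C, D, h2, h3⟩ := hz
  have hCD := h.polyFn_ne_zero h2
  have hAB : polyFn x y A B ≠ 0 := h3 ▸ mul_ne_zero h0 hCD
  obtain ⟨n, A', B', C', D', h4, h5, h6⟩ := h.exists_factor hP hAB
  have hCD' := h.polyFn_ne_zero h5
  refine ⟨n, polyFn x y A' B' * (polyFn x y C D * polyFn x y C' D')⁻¹,
    (unitAt_polyFn h4).mul h hP (((unitAt_polyFn h2).mul h hP (unitAt_polyFn h5)).inv h), ?_⟩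
  rw [← h3] at h6
  field_simp
  linear_combination h6

theorem exists_zpow_mul [CharZero K] (h : IsChart g x y) {r s : K} (hP : IsPoint g r s)
    {z : F} (h0 : z ≠ 0) :
    ∃ (n : ℤ) (u : F), UnitAt x y r s u ∧ z = uniformizer x y r s ^ n * u := by
  obtain ⟨A, B, C, hC, hz⟩ := h.exists_polyFn z
  have hC' := h.aeval_ne_zero hC
  obtain ⟨n, u, hu, e1⟩ := (regularAt_polyFn (x := x) (y := y) (r := r) (s := s) (A := A)
    (B := B)).exists_pow_mul h hP (hz ▸ mul_ne_zero h0 hC')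
  obtain ⟨m, w, hw, e2⟩ := (regularAt_polyFn (x := x) (y := y) (r := r) (s := s) (A := C)
    (B := 0)).exists_pow_mul h hP (by rwa [polyFn_zero_right])
  refine ⟨n - m, u * w⁻¹, hu.mul h hP (hw.inv h), ?_⟩
  have hπ := h.uniformizer_ne_zero r s
  have hw0 := hw.ne_zero h
  rw [polyFn_zero_right] at e2
  rw [e1, e2] at hz
  rw [zpow_sub₀ hπ, zpow_natCast, zpow_natCast]
  field_simp
  linear_combination hz

/-- If a positive power of the uniformizer were a unit, clearing denominators would give an identity
between polynomials in x and y. At (r, s) one side is nonzero, while the other contains the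
uniformizer as a factor. -/
theorem zpow_eq_zero_of_unitAt (h : IsChart g x y) {r s : K} (hP : IsPoint g r s)
    {n : ℤ} (hn : 0 ≤ n) (hu : UnitAt x y r s (uniformizer x y r s ^ n)) : n = 0 := by
  obtain ⟨k, rfl⟩ := Int.eq_ofNat_of_zero_le hn
  rcases k with - | k
  · rfl
  exfalso
  obtain ⟨A, B, C, D, h1, h2, h3⟩ := hu
  obtain ⟨P, Q, hPQ, hπ⟩ := exists_uniformizer_eq (x := x) (y := y) r s
  obtain ⟨A', B', C', D', h5, h6⟩ :=
    (regularAt_uniformizer (x := x) (y := y) r s).pow h hP k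
  rw [zpow_natCast, pow_succ] at h3
  have : polyFn x y (A * C' + B * D' * g) (A * D' + C' * B) =
      polyFn x y (P * (A' * C + B' * D * g) + Q * (A' * D + C * B') * g)
        (P * (A' * D + C * B') + (A' * C + B' * D * g) * Q) := by
    rw [h.polyFn_mul, h.polyFn_mul, h.polyFn_mul, ← h3, ← h6, hπ]
    ring
  obtain ⟨e1, e2⟩ := h.polyFn_inj this
  have h7 := polyVal_mul hP.sq A B C' D'
  rw [e1, e2, polyVal_mul hP.sq, hPQ, zero_mul] at h7
  exact mul_ne_zero h1 h5 h7.symm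

theorem zpow_mul_unique (h : IsChart g x y) {r s : K} (hP : IsPoint g r s) {n m : ℤ} {u w : F}
    (hu : UnitAt x y r s u) (hw : UnitAt x y r s w)
    (e : uniformizer x y r s ^ n * u = uniformizer x y r s ^ m * w) : n = m := by
  wlog hnm : m ≤ n generalizing n m u w
  · exact (this hw hu e.symm (by omega)).symm
  have hπ := h.uniformizer_ne_zero r s
  have hu0 := hu.ne_zero h
  have : uniformizer x y r s ^ (n - m) = w * u⁻¹ := by
    rw [zpow_sub₀ hπ]
    field_simp
    linear_combination e
  have := h.zpow_eq_zero_of_unitAt hP (n := n - m) (by omega) (this ▸ hw.mul h hP (hu.inv h))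
  omega

end IsChart

end Chart

/-! ## Places of a function field with an affine chart -/

section Places

open IntermediateField

variable {K F : Type} [Field K] [Field F] [Algebra K F]

namespace Place

theorem map_const_le_one (P : Place K F) (c : K) : P.1 (algebraMap K F c) ≤ 1 := by
  by_cases h : c = 0
  · simp [h]
  · exact (P.2.2 c h).le

theorem map_aeval_le_one (P : Place K F) {x : F} (hx : P.1 x ≤ 1) (p : K[X]) :
    P.1 (aeval x p) ≤ 1 := by
  induction p using Polynomial.induction_on' with
  | add p q hp hq => rw [map_add]; exact P.1.map_add_le hp hq
  | monomial n a =>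
    rw [aeval_monomial, map_mul, map_pow]
    exact mul_le_one' (P.map_const_le_one a) (pow_le_one' hx n)

theorem map_aeval_of_one_lt (P : Place K F) {x : F} (hx : 1 < P.1 x) {p : K[X]} (hp : p ≠ 0) :
    P.1 (aeval x p) = P.1 x ^ p.natDegree := by
  have : P.1.IsTrivialOn K := ⟨P.2.2⟩
  exact valuation_aeval_eq_valuation_X_pow_natDegree_of_one_lt_valuation_X x hx hp

/-- The place `P` lies over the point `(r, s)` of the affine plane with coordinates `(x, y)`. -/
structure IsAt (P : Place K F) (x y : F) (r s : K) : Prop where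
  left : P.1 (x - algebraMap K F r) < 1
  right : P.1 (y - algebraMap K F s) < 1

variable {P : Place K F} {x y : F} {r s : K}

theorem map_le_one_of_sub (h : P.1 (x - algebraMap K F r) < 1) : P.1 x ≤ 1 := by
  rw [← sub_add_cancel x (algebraMap K F r)]
  exact P.1.map_add_le h.le (P.map_const_le_one r)

theorem eq_of_map_sub_lt_one {r' : K} (h : P.1 (x - algebraMap K F r) < 1)
    (h' : P.1 (x - algebraMap K F r') < 1) : r = r' := by
  by_contra hne
  have h1 := P.2.2 (r' - r) (sub_ne_zero.2 (Ne.symm hne))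
  have h2 : algebraMap K F (r' - r) = (x - algebraMap K F r) - (x - algebraMap K F r') := by
    rw [map_sub]; ring
  rw [h2] at h1
  exact (P.1.map_sub_lt h h').ne h1

/-- Reduction modulo the maximal ideal is evaluation at (r, s): A - A(r) and B - B(r) are divisible
by x - r, and what remains is a constant multiple of y - s. -/
theorem IsAt.map_polyFn_sub_lt_one (h : P.IsAt x y r s) (A B : K[X]) :
    P.1 (polyFn x y A B - algebraMap K F (polyVal r s A B)) < 1 := by
  obtain ⟨A1, hA⟩ := IsChart.exists_eq_X_sub_C_mul (A := A - Polynomial.C (A.eval r)) (r := r)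
    (by simp)
  obtain ⟨B1, hB⟩ := IsChart.exists_eq_X_sub_C_mul (A := B - Polynomial.C (B.eval r)) (r := r)
    (by simp)
  have hx := map_le_one_of_sub h.left
  have hy := map_le_one_of_sub h.right
  have hA' := congrArg (aeval x) hA
  have hB' := congrArg (aeval x) hB
  simp only [map_sub, map_mul, aeval_C, aeval_X] at hA' hB'
  have e : polyFn x y A B - algebraMap K F (polyVal r s A B) =
      (x - algebraMap K F r) * (aeval x A1 + aeval x B1 * y) +
        algebraMap K F (B.eval r) * (y - algebraMap K F s) := by
    simp only [polyFn, polyVal, map_add, map_mul]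
    linear_combination hA' + y * hB'
  rw [e]
  refine P.1.map_add_lt ?_ ?_
  · rw [map_mul]
    refine (mul_le_of_le_one_right' (P.1.map_add_le (P.map_aeval_le_one hx _) ?_)).trans_lt h.left
    rw [map_mul]
    exact mul_le_one' (P.map_aeval_le_one hx _) hy
  · rw [map_mul]
    exact (mul_le_of_le_one_left' (P.map_const_le_one _)).trans_lt h.right

theorem IsAt.map_polyFn_le_one (h : P.IsAt x y r s) (A B : K[X]) :
    P.1 (polyFn x y A B) ≤ 1 :=
  map_le_one_of_sub (h.map_polyFn_sub_lt_one A B)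

theorem IsAt.map_polyFn_lt_one (h : P.IsAt x y r s) {A B : K[X]} (h0 : polyVal r s A B = 0) :
    P.1 (polyFn x y A B) < 1 := by
  simpa [h0] using h.map_polyFn_sub_lt_one A B

theorem IsAt.map_polyFn_eq_one (h : P.IsAt x y r s) {A B : K[X]} (h0 : polyVal r s A B ≠ 0) :
    P.1 (polyFn x y A B) = 1 := by
  have h1 := P.2.2 _ h0
  have h2 := h.map_polyFn_sub_lt_one A B
  exact (Valuation.map_eq_of_sub_lt P.1 (h2.trans_eq h1.symm)).trans h1

theorem IsAt.polyVal_eq_zero (h : P.IsAt x y r s) {A B : K[X]} (h0 : P.1 (polyFn x y A B) < 1) :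
    polyVal r s A B = 0 := by
  by_contra h1
  exact h0.ne (h.map_polyFn_eq_one h1)

theorem IsAt.map_unitAt (h : P.IsAt x y r s) {z : F} (hz : IsChart.UnitAt x y r s z) :
    P.1 z = 1 := by
  obtain ⟨A, B, C, D, h1, h2, h3⟩ := hz
  have := congrArg P.1 h3
  rwa [map_mul, h.map_polyFn_eq_one h1, h.map_polyFn_eq_one h2, mul_one] at this

/-- Surjectivity of the valuation is what normalizes it. Some z has order 1, and z is a power of the
uniformizer times a unit, so the order of the uniformizer divides 1; it is also positive. -/
theorem IsAt.map_uniformizer [CharZero K] {g : K[X]} (hc : IsChart g x y) (hP : IsPoint g r s)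
    (h : P.IsAt x y r s) : P.1 (IsChart.uniformizer x y r s) = WithZero.exp (-1 : ℤ) := by
  have hlt : P.1 (IsChart.uniformizer x y r s) < 1 := by
    obtain ⟨A, B, h1, h2⟩ := IsChart.exists_uniformizer_eq (x := x) (y := y) r s
    rw [h2]
    exact h.map_polyFn_lt_one h1
  have hne : P.1 (IsChart.uniformizer x y r s) ≠ 0 :=
    (Valuation.ne_zero_iff _).2 (hc.uniformizer_ne_zero r s)
  obtain ⟨z, hz⟩ := P.2.1 (WithZero.exp (-1 : ℤ))
  have hz0 : z ≠ 0 := by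
    rintro rfl
    exact WithZero.exp_ne_zero (hz.symm.trans (map_zero _))
  obtain ⟨n, u, hu, rfl⟩ := hc.exists_zpow_mul hP hz0
  rw [map_mul, h.map_unitAt hu, mul_one, map_zpow₀] at hz
  rw [← WithZero.exp_log hne] at hz hlt ⊢
  set k := WithZero.log (P.1 (IsChart.uniformizer x y r s))
  rw [← WithZero.exp_zsmul, WithZero.exp_inj, smul_eq_mul] at hz
  rw [← WithZero.exp_zero, WithZero.exp_lt_exp] at hlt
  have : k ∣ 1 := ⟨-n, by linarith⟩
  have := Int.isUnit_iff.1 (isUnit_of_dvd_one this)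
  congr 1
  omega

theorem IsAt.map_eq [CharZero K] {g : K[X]} (hc : IsChart g x y) (hP : IsPoint g r s)
    (h : P.IsAt x y r s) {n : ℤ} {u : F} (hu : IsChart.UnitAt x y r s u) :
    P.1 (IsChart.uniformizer x y r s ^ n * u) = WithZero.exp (-n) := by
  rw [map_mul, h.map_unitAt hu, mul_one, map_zpow₀, h.map_uniformizer hc hP,
    ← WithZero.exp_zsmul]
  simp

theorem IsAt.unique [CharZero K] {g : K[X]} (hc : IsChart g x y) (hP : IsPoint g r s)
    {Q : Place K F} (h : P.IsAt x y r s) (h' : Q.IsAt x y r s) : P = Q := by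
  apply Subtype.ext
  ext z
  by_cases hz : z = 0
  · simp [hz]
  · obtain ⟨n, u, hu, rfl⟩ := hc.exists_zpow_mul hP hz
    rw [h.map_eq hc hP hu, h'.map_eq hc hP hu]

/-- The valuation ring is the local ring of the point. This gives fractions that can be
differentiated explicitly when regular differentials are determined. -/
theorem IsAt.regularAt_of_map_le_one [CharZero K] {g : K[X]} (hc : IsChart g x y)
    (hP : IsPoint g r s) (h : P.IsAt x y r s) {z : F} (hz : P.1 z ≤ 1) :
    IsChart.RegularAt x y r s z := by
  by_cases hz0 : z = 0
  · exact ⟨0, 0, 1, 0, by simp [polyVal], by simp [hz0, polyFn]⟩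
  obtain ⟨n, u, hu, rfl⟩ := hc.exists_zpow_mul hP hz0
  rw [h.map_eq hc hP hu, ← WithZero.exp_zero, WithZero.exp_le_exp] at hz
  obtain ⟨k, rfl⟩ := Int.eq_ofNat_of_zero_le (show 0 ≤ n by omega)
  rw [zpow_natCast]
  exact ((IsChart.regularAt_uniformizer r s).pow hc hP k).mul hc hP hu.regularAt

end Place

/-! ### Existence of a place over each nonsingular point, and of a point under each place where x is
finite -/

namespace IsChart

variable {g : K[X]} {x y : F}

theorem UnitAt.polyVal_ne_zero (h : IsChart g x y) {r s : K} (hP : IsPoint g r s) {A B : K[X]}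
    (hu : UnitAt x y r s (polyFn x y A B)) : polyVal r s A B ≠ 0 := by
  obtain ⟨A', B', C, D, h1, h2, h3⟩ := hu
  rw [← h.polyFn_mul] at h3
  obtain ⟨rfl, rfl⟩ := h.polyFn_inj h3
  rw [polyVal_mul hP.sq] at h1
  exact left_ne_zero_of_mul h1

/-- The order of vanishing at `(r, s)`. -/
def pointOrd [CharZero K] (h : IsChart g x y) {r s : K} (hP : IsPoint g r s) (z : F) (hz : z ≠ 0) :
    ℤ := (h.exists_zpow_mul hP hz).choose

theorem pointOrd_eq [CharZero K] (h : IsChart g x y) {r s : K} (hP : IsPoint g r s)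
    {z : F} (hz : z ≠ 0) {n : ℤ} {u : F} (hu : UnitAt x y r s u)
    (e : z = uniformizer x y r s ^ n * u) : h.pointOrd hP z hz = n := by
  obtain ⟨w, hw, e'⟩ := (h.exists_zpow_mul hP hz).choose_spec
  exact h.zpow_mul_unique hP hw hu (e'.symm.trans e)

open Classical in
/-- The valuation attached to the point `(r, s)`. -/
def pointValuation [CharZero K] (h : IsChart g x y) {r s : K} (hP : IsPoint g r s) :
    Valuation F ℤᵐ⁰ where
  toFun z := if hz : z = 0 then 0 else WithZero.exp (-h.pointOrd hP z hz)
  map_zero' := by simp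
  map_one' := by
    rw [dif_neg one_ne_zero, h.pointOrd_eq hP one_ne_zero (n := 0) (unitAt_one r s) (by simp)]
    simp
  map_mul' z w := by
    by_cases hz : z = 0
    · simp [hz]
    by_cases hw : w = 0
    · simp [hw]
    obtain ⟨n, u, hu, e⟩ := h.exists_zpow_mul hP hz
    obtain ⟨m, v, hv, e'⟩ := h.exists_zpow_mul hP hw
    rw [dif_neg hz, dif_neg hw, dif_neg (mul_ne_zero hz hw), h.pointOrd_eq hP hz hu e,
      h.pointOrd_eq hP hw hv e', h.pointOrd_eq hP (mul_ne_zero hz hw) (hu.mul h hP hv)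
      (n := n + m) (by rw [e, e', zpow_add₀ (h.uniformizer_ne_zero r s)]; ring),
      ← WithZero.exp_add]
    congr 1
    ring
  map_add_le_max' z w := by
    by_cases hz : z = 0
    · simp [hz]
    by_cases hw : w = 0
    · simp [hw]
    by_cases hzw : z + w = 0
    · simp [hzw]
    -- The ultrametric inequality for the smaller order n: z + w = πⁿ(u + πᵏv) with k ≥ 0, and the
    -- bracket is regular, so its order is nonnegative.
    have key : ∀ z w : F, ∀ (hz : z ≠ 0) (hw : w ≠ 0) (hzw : z + w ≠ 0),
        h.pointOrd hP z hz ≤ h.pointOrd hP w hw →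
        h.pointOrd hP z hz ≤ h.pointOrd hP (z + w) hzw := by
      intro z w hz hw hzw hle
      obtain ⟨n, u, hu, e⟩ := h.exists_zpow_mul hP hz
      obtain ⟨m, v, hv, e'⟩ := h.exists_zpow_mul hP hw
      rw [h.pointOrd_eq hP hz hu e, h.pointOrd_eq hP hw hv e'] at hle
      rw [h.pointOrd_eq hP hz hu e]
      obtain ⟨k, hk⟩ := Int.eq_ofNat_of_zero_le (sub_nonneg.2 hle)
      obtain rfl : m = n + k := by omega
      have hπ := h.uniformizer_ne_zero r s
      have e3 : z + w = uniformizer x y r s ^ n * (u + uniformizer x y r s ^ k * v) := by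
        rw [e, e', zpow_add₀ hπ, zpow_natCast]; ring
      have hreg : RegularAt x y r s (u + uniformizer x y r s ^ k * v) :=
        hu.regularAt.add h hP (((regularAt_uniformizer r s).pow h hP k).mul h hP hv.regularAt)
      obtain ⟨j, t, ht, e4⟩ := hreg.exists_pow_mul h hP (fun h0 => hzw (by rw [e3, h0, mul_zero]))
      rw [h.pointOrd_eq hP hzw ht (n := n + j)
        (by rw [e3, e4, zpow_add₀ hπ, zpow_natCast]; ring)]
      omega
    rw [dif_neg hz, dif_neg hw, dif_neg hzw, le_max_iff, WithZero.exp_le_exp, WithZero.exp_le_exp]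
    rcases le_total (h.pointOrd hP z hz) (h.pointOrd hP w hw) with hle | hle
    · left
      have := key z w hz hw hzw hle
      omega
    · right
      have := key w z hw hz (by rwa [add_comm]) hle
      simp only [add_comm w z] at this
      omega

theorem pointValuation_eq [CharZero K] (h : IsChart g x y) {r s : K} (hP : IsPoint g r s)
    {n : ℤ} {u : F} (hu : UnitAt x y r s u) :
    h.pointValuation hP (uniformizer x y r s ^ n * u) = WithZero.exp (-n) := by
  have h0 : uniformizer x y r s ^ n * u ≠ 0 :=
    mul_ne_zero (zpow_ne_zero _ (h.uniformizer_ne_zero r s)) (hu.ne_zero h)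
  refine (dif_neg h0).trans ?_
  rw [ h.pointOrd_eq hP h0 hu rfl]

theorem exists_isAt [CharZero K] (h : IsChart g x y) {r s : K} (hP : IsPoint g r s) :
    ∃ P : Place K F, P.IsAt x y r s := by
  have hlt : ∀ A B : K[X], polyVal r s A B = 0 → h.pointValuation hP (polyFn x y A B) < 1 := by
    intro A B h0
    by_cases hz : polyFn x y A B = 0
    · simp [hz]
    obtain ⟨n, u, hu, e⟩ := regularAt_polyFn.exists_pow_mul h hP hz
    have hn : n ≠ 0 := by
      rintro rfl
      rw [pow_zero, one_mul] at e
      exact UnitAt.polyVal_ne_zero h hP (e ▸ hu) h0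
    rw [e, ← zpow_natCast, h.pointValuation_eq hP hu, ← WithZero.exp_zero, WithZero.exp_lt_exp]
    omega
  refine ⟨⟨h.pointValuation hP, ?_, ?_⟩, ?_, ?_⟩
  · intro v
    by_cases hv : v = 0
    · exact ⟨0, by simp [hv]⟩
    · refine ⟨uniformizer x y r s ^ (-WithZero.log v) * 1, ?_⟩
      rw [h.pointValuation_eq hP (unitAt_one r s), neg_neg, WithZero.exp_log hv]
  · intro c hc
    have hu : UnitAt x y r s (polyFn x y (Polynomial.C c) 0) := unitAt_polyFn (by simpa [polyVal])
    have := h.pointValuation_eq hP (n := 0) hu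
    simpa [polyFn] using this
  · have := hlt (X - Polynomial.C r) 0 (by simp [polyVal])
    rwa [polyFn_zero_right, map_sub, aeval_X, aeval_C] at this
  · have := hlt (-Polynomial.C s) 1 (by simp [polyVal])
    rw [polyFn] at this
    rw [sub_eq_neg_add]
    simpa using this

/-- Split p into linear factors: the leading coefficient has value 1, so some factor must have value
below 1. -/
theorem exists_root_of_map_lt_one [IsAlgClosed K] {P : Place K F} {p : K[X]}
    (hp : p ≠ 0) (hlt : P.1 (aeval x p) < 1) : ∃ r, P.1 (x - algebraMap K F r) < 1 := by
  have hs := IsAlgClosed.splits p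
  rw [hs.eq_prod_roots, map_mul, map_mul, aeval_C,
    P.2.2 _ (leadingCoeff_ne_zero.2 hp), one_mul, map_multiset_prod, map_multiset_prod,
    Multiset.map_map, Multiset.map_map] at hlt
  by_contra! hge
  refine hlt.not_ge (Multiset.one_le_prod ?_)
  intro v hv
  obtain ⟨r, -, rfl⟩ := Multiset.mem_map.1 hv
  simpa using hge r

/-- A place at which `x` is finite lies over an affine point. -/
theorem exists_isAt_of_map_le_one [IsAlgClosed K] (h : IsChart g x y) (P : Place K F)
    (hx : P.1 x ≤ 1) : ∃ r s, s ^ 2 = g.eval r ∧ P.IsAt x y r s := by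
  -- If every nonzero p(x) had value 1, every function (A + By)/C would have value at most 1,
  -- against surjectivity.
  have h1 : ∃ p : K[X], p ≠ 0 ∧ P.1 (aeval x p) < 1 := by
    by_contra! hge
    have hone : ∀ p : K[X], p ≠ 0 → P.1 (aeval x p) = 1 := fun p hp =>
      le_antisymm (P.map_aeval_le_one hx p) (hge p hp)
    obtain ⟨z, hz⟩ := P.2.1 (WithZero.exp (1 : ℤ))
    obtain ⟨A, B, C, hC, e⟩ := h.exists_polyFn z
    have h2 := congrArg P.1 e
    rw [map_mul, hz, hone C hC, mul_one] at h2
    have hy : P.1 y ≤ 1 := by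
      have := P.map_aeval_le_one hx g
      rw [← h.sq, map_pow] at this
      exact (pow_le_one_iff two_ne_zero).1 this
    have h3 : P.1 (polyFn x y A B) ≤ 1 := by
      refine P.1.map_add_le (P.map_aeval_le_one hx _) ?_
      rw [map_mul]
      exact mul_le_one' (P.map_aeval_le_one hx _) hy
    rw [← h2, ← WithZero.exp_zero, WithZero.exp_le_exp] at h3
    omega
  obtain ⟨p, hp, hlt⟩ := h1
  obtain ⟨r, hr⟩ := exists_root_of_map_lt_one hp hlt
  obtain ⟨c, hc⟩ := IsAlgClosed.exists_pow_nat_eq (g.eval r) two_pos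
  obtain ⟨g1, hg⟩ := exists_eq_X_sub_C_mul (A := g - Polynomial.C (g.eval r)) (r := r) (by simp)
  have hg' := congrArg (aeval x) hg
  simp only [map_sub, map_mul, aeval_C, aeval_X, ← h.sq, ← hc, map_pow] at hg'
  -- With c² = g(r), the product y² - c² = g(x) - g(r) is divisible by x - r, so one of the two
  -- factors is small and its sign selects the point.
  have h2 : P.1 ((y - algebraMap K F c) * (y + algebraMap K F c)) < 1 := by
    have : (y - algebraMap K F c) * (y + algebraMap K F c) =
      (x - algebraMap K F r) * aeval x g1 := by linear_combination hg'
    rw [this, map_mul]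
    exact (mul_le_of_le_one_right' (P.map_aeval_le_one hx _)).trans_lt hr
  by_cases h3 : P.1 (y - algebraMap K F c) < 1
  · exact ⟨r, c, hc, hr, h3⟩
  · refine ⟨r, -c, by rw [neg_sq, hc], hr, ?_⟩
    rw [map_neg, sub_neg_eq_add]
    by_contra h4
    rw [not_lt] at h3 h4
    rw [map_mul] at h2
    exact h2.not_ge (one_le_mul h3 h4)

end IsChart

/-! ### Orders of the coordinate functions at a point -/

namespace Place

variable {P : Place K F} {g : K[X]} {x y : F} {r s : K} [CharZero K]

theorem IsAt.map_sub_of_ne_zero (hc : IsChart g x y) (hP : IsPoint g r s)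
    (h : P.IsAt x y r s) (hs : s ≠ 0) :
    P.1 (x - algebraMap K F r) = WithZero.exp (-1 : ℤ) := by
  have := h.map_uniformizer hc hP
  rwa [IsChart.uniformizer, if_neg hs] at this

theorem IsAt.map_y_of_eq_zero (hc : IsChart g x y) (hP : IsPoint g r 0)
    (h : P.IsAt x y r 0) : P.1 y = WithZero.exp (-1 : ℤ) := by
  have := h.map_uniformizer hc hP
  rwa [IsChart.uniformizer, if_pos rfl] at this

/-- Ramification at a Weierstrass point: y² = (x - r)g₁(x) with g₁(r) ≠ 0, and y has order 1. -/
theorem IsAt.map_sub_of_eq_zero (hc : IsChart g x y) (hP : IsPoint g r 0)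
    (h : P.IsAt x y r 0) : P.1 (x - algebraMap K F r) = WithZero.exp (-2 : ℤ) := by
  have hg : g.eval r = 0 := by rw [← hP.sq]; simp
  obtain ⟨g1, rfl⟩ := IsChart.exists_eq_X_sub_C_mul hg
  have hg1r : g1.eval r ≠ 0 := by
    have := hP.nonsing
    simpa using this
  have h1 : P.1 (aeval x g1) = 1 := by
    rw [← polyFn_zero_right x y]
    exact h.map_polyFn_eq_one (by simpa [polyVal])
  have h2 := congrArg P.1 hc.sq
  simp only [map_mul, map_sub, aeval_X, aeval_C] at h2
  rw [map_pow, h.map_y_of_eq_zero hc hP, h1, mul_one] at h2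
  rw [← h2, ← WithZero.exp_nsmul]
  rfl

theorem IsAt.map_aeval_of_ne_zero (hc : IsChart g x y) (hP : IsPoint g r s)
    (h : P.IsAt x y r s) (hs : s ≠ 0) {p : K[X]} (hp : p ≠ 0) :
    P.1 (aeval x p) = WithZero.exp (-(rootMultiplicity r p : ℤ)) := by
  obtain ⟨q, hq1, hq2⟩ := exists_eq_pow_rootMultiplicity_mul_and_not_dvd _ hp r
  have h1 : P.1 (aeval x q) = 1 := by
    rw [← polyFn_zero_right x y]
    refine h.map_polyFn_eq_one ?_
    simp only [polyVal, eval_zero, zero_mul, add_zero]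
    exact fun h5 => hq2 (dvd_iff_isRoot.2 h5)
  conv_lhs => rw [hq1]
  simp only [map_mul, map_sub, aeval_X, aeval_C, map_pow]
  rw [h1, mul_one, h.map_sub_of_ne_zero hc hP hs, ← WithZero.exp_nsmul]
  congr 1
  simp

end Place

end Places

/-! ## Curves with a rational Weierstrass point

The chart `V² = G(u)` with `deg G = 5` covers the curve up to one place, which is the point
`(w, 0)` of the chart `y² = g(x)`. -/

section Model

open IntermediateField

variable {K F : Type} [Field K] [Field F] [Algebra K F]

/-- Two charts `y² = g(x)` and `V² = G(u)`, with `u = 1 / (x - w)` and `V = y / (x - w)³`, where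
`w` is a simple root of `g` and `G` is a separable quintic. -/
structure IsModel (g G : K[X]) (w : K) (x y u V : F) : Prop where
  chart : IsChart g x y
  chart' : IsChart G u V
  isPoint : IsPoint g w 0
  u_mul : u * (x - algebraMap K F w) = 1
  V_mul : V * (x - algebraMap K F w) ^ 3 = y
  sep : G.Separable
  natDegree : G.natDegree = 5

/-- The second chart of a model is automatically a chart. -/
theorem IsChart.inverse {g G : K[X]} {w : K} {x y u V : F} (h : IsChart g x y)
    (hu : u * (x - algebraMap K F w) = 1) (hV : V * (x - algebraMap K F w) ^ 3 = y)
    (hG : V ^ 2 = aeval u G) : IsChart G u V := by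
  have hx0 : x - algebraMap K F w ≠ 0 := right_ne_zero_of_mul_eq_one hu
  have hu' : u = (x - algebraMap K F w)⁻¹ := eq_inv_of_mul_eq_one_left hu
  have hx' : x = u⁻¹ + algebraMap K F w := by rw [hu', inv_inv, sub_add_cancel]
  have hmem : u ∈ K⟮x⟯ := by
    rw [hu']
    exact inv_mem (sub_mem (mem_adjoin_simple_self K x) (IntermediateField.algebraMap_mem _ w))
  have hmem' : x ∈ K⟮u⟯ := by
    have : u⁻¹ + algebraMap K F w ∈ K⟮u⟯ :=
      add_mem (inv_mem (mem_adjoin_simple_self K u)) (IntermediateField.algebraMap_mem _ w)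
    rwa [← hx'] at this
  have hadj : K⟮u⟯ = K⟮x⟯ :=
    le_antisymm (adjoin_simple_le_iff.2 hmem) (adjoin_simple_le_iff.2 hmem')
  have hc : x - algebraMap K F w ∈ K⟮x⟯ :=
    sub_mem (mem_adjoin_simple_self K x) (IntermediateField.algebraMap_mem _ w)
  refine ⟨?_, hG, ?_, ?_⟩
  · intro halg
    apply h.transcendental
    rw [hx']
    exact halg.inv.add (isAlgebraic_algebraMap w)
  · rw [hadj]
    intro hVm
    exact h.not_mem (hV ▸ mul_mem hVm (pow_mem hc 3))
  · intro z
    obtain ⟨a, ha, b, hb, rfl⟩ := h.gen z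
    rw [hadj]
    exact ⟨a, ha, b * (x - algebraMap K F w) ^ 3, mul_mem hb (pow_mem hc 3), by rw [← hV]; ring⟩

/-- A separable G makes every affine point of the second chart nonsingular. -/
theorem Polynomial.Separable.isPoint {G : K[X]} (h : G.Separable) {r s : K}
    (hs : s ^ 2 = G.eval r) : IsPoint G r s := by
  refine ⟨hs, ?_⟩
  by_cases h0 : s = 0
  · right
    subst h0
    have := h.aeval_derivative_ne_zero (x := r) (by simp [← hs])
    simpa using this
  · exact Or.inl h0

namespace IsModel

variable [CharZero K] {g G : K[X]} {w : K} {x y u V : F}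

/-- The place outside of the second chart. -/
def infinity (h : IsModel g G w x y u V) : Place K F := (h.chart.exists_isAt h.isPoint).choose

theorem infinity_isAt (h : IsModel g G w x y u V) : h.infinity.IsAt x y w 0 :=
  (h.chart.exists_isAt h.isPoint).choose_spec

theorem infinity_sub (h : IsModel g G w x y u V) :
    h.infinity.1 (x - algebraMap K F w) = WithZero.exp (-2 : ℤ) :=
  h.infinity_isAt.map_sub_of_eq_zero h.chart h.isPoint

theorem infinity_u (h : IsModel g G w x y u V) : h.infinity.1 u = WithZero.exp (2 : ℤ) := by
  have := congrArg h.infinity.1 h.u_mul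
  rw [map_mul, h.infinity_sub, map_one] at this
  rw [eq_inv_of_mul_eq_one_left this, ← WithZero.exp_neg]
  rfl

/-- Here y has order 1 and (x - w)³ has order 6. -/
theorem infinity_V (h : IsModel g G w x y u V) : h.infinity.1 V = WithZero.exp (5 : ℤ) := by
  have := congrArg h.infinity.1 h.V_mul
  rw [map_mul, map_pow, h.infinity_sub, h.infinity_isAt.map_y_of_eq_zero h.chart h.isPoint,
    ← WithZero.exp_nsmul] at this
  rw [(eq_mul_inv_iff_mul_eq₀ WithZero.exp_ne_zero).2 this, ← WithZero.exp_neg, ← WithZero.exp_add]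
  rfl

theorem infinity_aeval (h : IsModel g G w x y u V) {p : K[X]} (hp : p ≠ 0) :
    h.infinity.1 (aeval u p) = WithZero.exp (2 * p.natDegree : ℤ) := by
  have hu : 1 < h.infinity.1 u := by
    rw [h.infinity_u, ← WithZero.exp_zero, WithZero.exp_lt_exp]
    norm_num
  rw [h.infinity.map_aeval_of_one_lt hu hp, h.infinity_u, ← WithZero.exp_nsmul]
  congr 1
  simp [mul_comm]

theorem one_lt_infinity_u (h : IsModel g G w x y u V) : 1 < h.infinity.1 u := by
  rw [h.infinity_u, ← WithZero.exp_zero, WithZero.exp_lt_exp]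
  norm_num

/-- A pole of u is a zero of x - w, and (w, 0) is the only point of the first chart over w because
g(w) = 0. -/
theorem eq_infinity_or_isAt [IsAlgClosed K] (h : IsModel g G w x y u V) (P : Place K F) :
    P = h.infinity ∨ ∃ r s, s ^ 2 = G.eval r ∧ P.IsAt u V r s := by
  by_cases hP : P.1 u ≤ 1
  · exact Or.inr (h.chart'.exists_isAt_of_map_le_one P hP)
  left
  have h1 := congrArg P.1 h.u_mul
  rw [map_mul, map_one] at h1
  have h2 : P.1 (x - algebraMap K F w) < 1 := by
    by_contra h3
    rw [not_lt] at h3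
    rw [not_le] at hP
    refine h1.not_gt (hP.trans_le ?_)
    exact le_mul_of_one_le_right' h3
  obtain ⟨r, s, hs, hat⟩ := h.chart.exists_isAt_of_map_le_one P (Place.map_le_one_of_sub h2)
  obtain rfl := Place.eq_of_map_sub_lt_one hat.left h2
  have : s = 0 := by
    rw [← h.isPoint.sq] at hs
    simpa using hs
  subst this
  exact hat.unique h.chart h.isPoint h.infinity_isAt

theorem not_infinity_isAt (h : IsModel g G w x y u V) {r s : K} :
    ¬ h.infinity.IsAt u V r s := fun hat =>
  h.one_lt_infinity_u.not_ge (Place.map_le_one_of_sub hat.left)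

/-- A function without poles in the second chart is a polynomial in `u` and `V`. -/
theorem exists_polyFn_of_regular [IsAlgClosed K] (h : IsModel g G w x y u V) {φ : F}
    (hφ : ∀ (P : Place K F) (r s : K), s ^ 2 = G.eval r → P.IsAt u V r s → P.1 φ ≤ 1) :
    ∃ A B : K[X], φ = polyFn u V A B := by
  obtain ⟨A, B, C, hC, e⟩ := h.chart'.exists_polyFn φ
  -- Induction on the degree of the denominator C: each root r of C is shown to be a common root of
  -- A and B, and is then cancelled.
  induction hn : C.natDegree using Nat.strong_induction_on generalizing A B C with
  | _ n ih =>
  by_cases hdeg : C.natDegree = 0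
  · obtain ⟨c, rfl⟩ := natDegree_eq_zero.1 hdeg
    have hc : c ≠ 0 := by
      rintro rfl
      simp at hC
    have hc' : algebraMap K F c ≠ 0 := by simpa using hc
    refine ⟨Polynomial.C c⁻¹ * A, Polynomial.C c⁻¹ * B, ?_⟩
    have : polyFn u V (Polynomial.C c⁻¹ * A) (Polynomial.C c⁻¹ * B) =
      algebraMap K F c⁻¹ * polyFn u V A B := by simp [polyFn]; ring
    rw [this, ← e, map_inv₀, aeval_C]
    field_simp
  obtain ⟨r, hr⟩ := IsAlgClosed.exists_root C
    (fun h0 => hdeg (natDegree_eq_zero_iff_degree_le_zero.2 h0.le))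
  obtain ⟨s, hs⟩ := IsAlgClosed.exists_pow_nat_eq (G.eval r) two_pos
  obtain ⟨C', rfl⟩ := IsChart.exists_eq_X_sub_C_mul hr
  have hC' : C' ≠ 0 := right_ne_zero_of_mul hC
  have hsmall : ∀ (P : Place K F) (t : K), t ^ 2 = G.eval r → P.IsAt u V r t →
      P.1 (polyFn u V A B) ≤ P.1 (u - algebraMap K F r) := by
    intro P t ht hat
    rw [← e, map_mul (aeval u), map_sub, aeval_X, aeval_C, map_mul, map_mul]
    refine (mul_le_of_le_one_left' (hφ P r t ht hat)).trans ?_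
    exact mul_le_of_le_one_right' (P.map_aeval_le_one (Place.map_le_one_of_sub hat.left) _)
  have hval : ∀ t : K, t ^ 2 = G.eval r → polyVal r t A B = 0 := by
    intro t ht
    obtain ⟨P, hat⟩ := h.chart'.exists_isAt (h.sep.isPoint ht)
    exact hat.polyVal_eq_zero ((hsmall P t ht hat).trans_lt hat.left)
  -- The numerator vanishes at both (r, s) and (r, -s). Adding gives A(r) = 0, and when s ≠ 0 also
  -- B(r) = 0.
  have h1 := hval s hs
  have h2 := hval (-s) (by rw [neg_sq, hs])
  unfold polyVal at h1 h2
  have hA : A.eval r = 0 := by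
    have : (2 : K) * A.eval r = 0 := by linear_combination h1 + h2
    simpa using this
  obtain ⟨A', rfl⟩ := IsChart.exists_eq_X_sub_C_mul hA
  have hB : B.eval r = 0 := by
    -- At a Weierstrass point the two conjugate points coincide. There u - r has order 2 and V only
    -- order 1, so divisibility of B(u)V by u - r still forces B(r) = 0.
    by_cases hs0 : s = 0
    · subst hs0
      have hpt := h.sep.isPoint hs
      obtain ⟨P, hat⟩ := h.chart'.exists_isAt hpt
      have h3 := hsmall P 0 hs hat
      have h4 : P.1 (aeval u B * V) ≤ P.1 (u - algebraMap K F r) := by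
        have e2 : aeval u B * V = polyFn u V ((X - Polynomial.C r) * A') B -
            (u - algebraMap K F r) * aeval u A' := by
          simp [polyFn]
        rw [e2]
        refine P.1.map_sub_le h3 ?_
        rw [map_mul]
        exact mul_le_of_le_one_right' (P.map_aeval_le_one (Place.map_le_one_of_sub hat.left) _)
      rw [map_mul, hat.map_y_of_eq_zero h.chart' hpt, hat.map_sub_of_eq_zero h.chart' hpt] at h4
      have h5 : P.1 (aeval u B) < 1 := by
        by_contra h6
        rw [not_lt] at h6
        have h7 : WithZero.exp (-1 : ℤ) ≤ WithZero.exp (-2 : ℤ) :=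
          (le_mul_of_one_le_left' h6).trans h4
        rw [WithZero.exp_le_exp] at h7
        omega
      rw [← polyFn_zero_right u V] at h5
      simpa [polyVal] using hat.polyVal_eq_zero h5
    · simpa [hA, hs0] using h1
  obtain ⟨B', rfl⟩ := IsChart.exists_eq_X_sub_C_mul hB
  have hr0 : aeval u (X - Polynomial.C r) ≠ 0 := h.chart'.aeval_ne_zero (X_sub_C_ne_zero r)
  refine ih C'.natDegree ?_ A' B' C' hC' ?_ rfl
  · rw [← hn, natDegree_mul (X_sub_C_ne_zero r) hC', natDegree_X_sub_C]
    omega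
  · apply mul_left_cancel₀ hr0
    simp only [polyFn, map_mul] at e ⊢
    linear_combination e

/-- Functions whose only pole is at infinity, of order at most `m`. -/
theorem exists_polyFn_of_pole_le [IsAlgClosed K] (h : IsModel g G w x y u V) {φ : F} {m : ℤ}
    (hφ : ∀ (P : Place K F) (r s : K), s ^ 2 = G.eval r → P.IsAt u V r s → P.1 φ ≤ 1)
    (hinf : h.infinity.1 φ ≤ WithZero.exp m) :
    ∃ A B : K[X], φ = polyFn u V A B ∧ (A ≠ 0 → 2 * (A.natDegree : ℤ) ≤ m) ∧
      (B ≠ 0 → 2 * (B.natDegree : ℤ) + 5 ≤ m) := by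
  obtain ⟨A, B, rfl⟩ := h.exists_polyFn_of_regular hφ
  refine ⟨A, B, rfl, ?_⟩
  have hBV : B ≠ 0 → h.infinity.1 (aeval u B * V) = WithZero.exp (2 * B.natDegree + 5 : ℤ) := by
    intro hB
    rw [map_mul, h.infinity_aeval hB, h.infinity_V, ← WithZero.exp_add]
  by_cases hA : A = 0
  · refine ⟨fun hA' => absurd hA hA', fun hB => ?_⟩
    rwa [polyFn, hA, map_zero, zero_add, hBV hB, WithZero.exp_le_exp] at hinf
  by_cases hB : B = 0
  · refine ⟨fun _ => ?_, fun hB' => absurd hB hB'⟩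
    rwa [hB, polyFn_zero_right, h.infinity_aeval hA, WithZero.exp_le_exp] at hinf
  -- The pole orders 2 deg A and 2 deg B + 5 have different parity, so the larger one is the pole
  -- order of the sum.
  have hne : h.infinity.1 (aeval u A) ≠ h.infinity.1 (aeval u B * V) := by
    rw [hBV hB, h.infinity_aeval hA, Ne, WithZero.exp_inj]
    omega
  rw [polyFn, Valuation.map_add_of_distinct_val _ hne, max_le_iff, hBV hB, h.infinity_aeval hA,
    WithZero.exp_le_exp, WithZero.exp_le_exp] at hinf
  exact ⟨fun _ => hinf.1, fun _ => hinf.2⟩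

end IsModel

end Model

/-! ## Differentials and the genus -/

section Differentials

open IntermediateField

variable {K F : Type} [Field K] [Field F] [Algebra K F]

namespace IsChart

variable {g : K[X]} {x y : F}

theorem y_ne_zero (h : IsChart g x y) : y ≠ 0 := fun hy => h.not_mem (hy ▸ zero_mem _)

theorem adjoin_eq_top (h : IsChart g x y) : IntermediateField.adjoin K {x, y} = ⊤ := by
  rw [eq_top_iff]
  intro z _
  obtain ⟨a, ha, b, hb, rfl⟩ := h.gen z
  have hle : K⟮x⟯ ≤ IntermediateField.adjoin K {x, y} :=
    IntermediateField.adjoin.mono K _ _ (by simp)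
  exact add_mem (hle ha) (mul_mem (hle hb) (IntermediateField.subset_adjoin K _ (by simp)))

/-- The differential `dx / y`. -/
def invariantDifferential (K : Type) {F : Type} [Field K] [Field F] [Algebra K F] (x y : F) :
    Ω[F⁄K] := y⁻¹ • KaehlerDifferential.D K F x

theorem D_x (h : IsChart g x y) :
    KaehlerDifferential.D K F x = y • invariantDifferential K x y := by
  rw [invariantDifferential, smul_inv_smul₀ h.y_ne_zero]

theorem D_y (h : IsChart g x y) : (2 : F) • KaehlerDifferential.D K F y =
    aeval x (derivative g) • invariantDifferential K x y := by
  have h1 := congrArg (KaehlerDifferential.D K F) h.sq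
  rw [Derivation.map_aeval, Derivation.leibniz_pow, h.D_x] at h1
  apply smul_right_injective _ h.y_ne_zero
  simp only [pow_one, Nat.add_one_sub_one, ← Nat.cast_smul_eq_nsmul F, Nat.cast_ofNat] at h1 ⊢
  rw [smul_comm y, h1, smul_comm]

/-- F is finitely generated as a field over K. If its differentials vanished it would be unramified,
hence algebraic, over K, contradicting the transcendence of x. -/
theorem not_subsingleton_kaehler (h : IsChart g x y) : ¬ Subsingleton Ω[F⁄K] := by
  intro hs
  have : Algebra.EssFiniteType K F := by
    have h1 : (⊤ : IntermediateField K F).FG := by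
      rw [← h.adjoin_eq_top]
      exact IntermediateField.fg_adjoin_of_finite (Set.toFinite _)
    exact IntermediateField.fg_top_iff.1 h1
  have : Algebra.FormallyUnramified K F := ⟨hs⟩
  have := Algebra.FormallyUnramified.isSeparable K F
  exact h.transcendental (Algebra.IsAlgebraic.isAlgebraic x)

variable [CharZero K]

/-- Since dx = y·(dx/y) and dy = ½g'(x)·(dx/y), the coefficient of dx/y in d(A + By) is again a
polynomial in x and y, hence has no pole in the chart. -/
theorem D_polyFn (h : IsChart g x y) (A B : K[X]) :
    KaehlerDifferential.D K F (polyFn x y A B) =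
      polyFn x y (derivative B * g + Polynomial.C 2⁻¹ * B * derivative g) (derivative A) •
        invariantDifferential K x y := by
  have : CharZero F := charZero_of_injective_algebraMap (algebraMap K F).injective
  have hy : KaehlerDifferential.D K F y =
      ((2 : F)⁻¹ * aeval x (derivative g)) • invariantDifferential K x y := by
    rw [mul_smul, ← h.D_y, inv_smul_smul₀ two_ne_zero]
  simp only [polyFn, map_add, Derivation.leibniz, Derivation.map_aeval, h.D_x, hy, smul_smul,
    ← add_smul, map_mul, aeval_C, map_inv₀, map_ofNat, ← h.sq]
  congr 1
  ring

theorem exists_D_eq (h : IsChart g x y) (z : F) :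
    ∃ c : F, KaehlerDifferential.D K F z = c • invariantDifferential K x y := by
  obtain ⟨A, B, C, hC, e⟩ := h.exists_polyFn z
  have hC' := h.aeval_ne_zero hC
  have h1 := congrArg (KaehlerDifferential.D K F) e
  rw [Derivation.leibniz, h.D_polyFn, Derivation.map_aeval, h.D_x, smul_smul, smul_smul] at h1
  have h2 := eq_sub_of_add_eq' h1
  rw [← sub_smul] at h2
  exact ⟨_, (inv_smul_smul₀ hC' _).symm.trans ((congrArg _ h2).trans (smul_smul _ _ _))⟩

theorem exists_eq_smul (h : IsChart g x y) (η : Ω[F⁄K]) :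
    ∃ c : F, η = c • invariantDifferential K x y := by
  have hη : η ∈ Submodule.span F (Set.range (KaehlerDifferential.D K F)) := by
    rw [KaehlerDifferential.span_range_derivation]
    trivial
  induction hη using Submodule.span_induction with
  | mem η h1 =>
    obtain ⟨z, rfl⟩ := h1
    exact h.exists_D_eq z
  | zero => exact ⟨0, by simp⟩
  | add a b _ _ ha hb =>
    obtain ⟨c, rfl⟩ := ha
    obtain ⟨d, rfl⟩ := hb
    exact ⟨c + d, by rw [add_smul]⟩
  | smul t a _ ha =>
    obtain ⟨c, rfl⟩ := ha
    exact ⟨t * c, by rw [mul_smul]⟩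

theorem invariantDifferential_ne_zero (h : IsChart g x y) : invariantDifferential K x y ≠ 0 := by
  intro h0
  refine h.not_subsingleton_kaehler ⟨fun a b => ?_⟩
  obtain ⟨c, rfl⟩ := h.exists_eq_smul a
  obtain ⟨d, rfl⟩ := h.exists_eq_smul b
  rw [h0, smul_zero, smul_zero]

/-- The differentials that are regular at a point of the chart are the regular multiples of
`dx / y`. -/
theorem smul_invariantDifferential_mem_span_iff (h : IsChart g x y) {r s : K}
    (hP : IsPoint g r s) {P : Place K F} (hat : P.IsAt x y r s) (φ : F) :
    φ • invariantDifferential K x y ∈ Submodule.span P.1.integer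
      (Set.range fun b : P.1.integer => KaehlerDifferential.D K F (b : F)) ↔ P.1 φ ≤ 1 := by
  have : CharZero F := charZero_of_injective_algebraMap (algebraMap K F).injective
  constructor
  · intro hmem
    obtain ⟨c, hc, e⟩ : ∃ c : F, P.1 c ≤ 1 ∧ φ • invariantDifferential K x y =
        c • invariantDifferential K x y := by
      generalize φ • invariantDifferential K x y = η at hmem
      induction hmem using Submodule.span_induction with
      | mem η h1 =>
        obtain ⟨⟨z, hz⟩, rfl⟩ := h1
        -- Write z = p/q with q a unit at the point. In dz = q⁻¹(dp - z dq), all coefficients of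
        -- dx/y are regular.
        obtain ⟨A, B, C, D, h2, h3⟩ := hat.regularAt_of_map_le_one h hP hz
        have h1 := congrArg (KaehlerDifferential.D K F) h3
        have hq := hat.map_polyFn_eq_one h2
        have hq0 := h.polyFn_ne_zero h2
        rw [Derivation.leibniz, h.D_polyFn, h.D_polyFn, smul_smul] at h1
        have h2 := eq_sub_of_add_eq' h1
        rw [← sub_smul] at h2
        refine ⟨_, ?_, (inv_smul_smul₀ hq0 _).symm.trans ((congrArg _ h2).trans (smul_smul _ _ _))⟩
        · rw [map_mul, map_inv₀, hq, inv_one, one_mul]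
          refine P.1.map_sub_le (hat.map_polyFn_le_one _ _) ?_
          rw [map_mul]
          exact mul_le_one' hz (hat.map_polyFn_le_one _ _)
      | zero => exact ⟨0, by simp, by simp⟩
      | add a b _ _ ha hb =>
        obtain ⟨c, hc, rfl⟩ := ha
        obtain ⟨d, hd, rfl⟩ := hb
        exact ⟨c + d, P.1.map_add_le hc hd, by rw [add_smul]⟩
      | smul t a _ ha =>
        obtain ⟨c, hc, rfl⟩ := ha
        refine ⟨t * c, ?_, by rw [mul_smul]; rfl⟩
        rw [map_mul]
        exact mul_le_one' t.2 hc
    rw [smul_left_injective F h.invariantDifferential_ne_zero e]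
    exact hc
  · intro hφ
    have hx : P.1 x ≤ 1 := Place.map_le_one_of_sub hat.left
    have hy : P.1 y ≤ 1 := Place.map_le_one_of_sub hat.right
    have hD : ∀ b c : F, P.1 b ≤ 1 → P.1 c ≤ 1 →
        c • KaehlerDifferential.D K F b ∈ Submodule.span P.1.integer
          (Set.range fun b : P.1.integer => KaehlerDifferential.D K F (b : F)) := by
      intro b c hb hc
      have h1 : KaehlerDifferential.D K F b ∈ Submodule.span P.1.integer
          (Set.range fun b : P.1.integer => KaehlerDifferential.D K F (b : F)) :=
        Submodule.subset_span ⟨⟨b, hb⟩, rfl⟩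
      exact Submodule.smul_mem _ (⟨c, hc⟩ : P.1.integer) h1
    -- The differential of the uniformizer serves as generator: dx/y = 2dy/g'(x) at a Weierstrass
    -- point, where g'(r) ≠ 0, and dx/y with y a unit elsewhere.
    by_cases hs : s = 0
    · subst hs
      have hg : polyVal r 0 (derivative g) 0 ≠ 0 := by
        have := hP.nonsing
        simpa [polyVal] using this
      have h1 := hat.map_polyFn_eq_one hg
      have h0 := h.polyFn_ne_zero hg
      rw [polyFn_zero_right] at h1 h0
      have h2 : φ • invariantDifferential K x y =
          (2 * φ * (aeval x (derivative g))⁻¹) • KaehlerDifferential.D K F y := by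
        have e : 2 * φ * (aeval x (derivative g))⁻¹ = (φ * (aeval x (derivative g))⁻¹) * 2 := by
          ring
        rw [e, mul_smul, h.D_y, smul_smul, inv_mul_cancel_right₀ h0]
      rw [h2]
      refine hD _ _ hy ?_
      have h2' : P.1 (2 : F) ≤ 1 := by
        have := P.map_const_le_one (2 : K)
        rwa [map_ofNat] at this
      rw [map_mul, map_mul, map_inv₀, h1, inv_one, mul_one]
      exact mul_le_one' h2' hφ
    · have h1 : P.1 y = 1 := by
        have : polyVal r s (0 : K[X]) 1 ≠ 0 := by simpa [polyVal]
        have := hat.map_polyFn_eq_one this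
        simpa [polyFn] using this
      have h2 : φ • invariantDifferential K x y = (φ * y⁻¹) • KaehlerDifferential.D K F x := by
        rw [invariantDifferential, smul_smul]
      rw [h2]
      refine hD _ _ hx ?_
      rw [map_mul, map_inv₀, h1, inv_one, mul_one]
      exact hφ

end IsChart

namespace IsModel

variable {g G : K[X]} {w : K} {x y u V : F}

/-- With t = x - w one has du = -dx/t² and V = y/t³. Thus du/V gains a factor t, which is a double
zero at infinity. -/
theorem invariantDifferential_eq (h : IsModel g G w x y u V) :
    IsChart.invariantDifferential K u V =
      (-(x - algebraMap K F w)) • IsChart.invariantDifferential K x y := by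
  set t := x - algebraMap K F w with ht
  have ht0 : t ≠ 0 := right_ne_zero_of_mul_eq_one h.u_mul
  have hV0 := h.chart'.y_ne_zero
  have h1 := congrArg (KaehlerDifferential.D K F) h.u_mul
  have hDt : KaehlerDifferential.D K F t = KaehlerDifferential.D K F x := by
    rw [ht, map_sub, Derivation.map_algebraMap, sub_zero]
  rw [Derivation.leibniz, Derivation.map_one_eq_zero, hDt] at h1
  have h2 := eq_neg_of_add_eq_zero_right h1
  have hu : u = t⁻¹ := eq_inv_of_mul_eq_one_left h.u_mul
  have h3 : KaehlerDifferential.D K F u = (-(t⁻¹ * u)) • KaehlerDifferential.D K F x := by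
    rw [neg_smul, mul_smul, ← smul_neg, ← h2, inv_smul_smul₀ ht0]
  rw [IsChart.invariantDifferential, IsChart.invariantDifferential, h3, smul_smul, smul_smul,
    ← h.V_mul, hu, ← ht]
  congr 1
  field_simp

variable [CharZero K]

/-- The double zero of du/V at infinity allows φ a pole of order at most 2 there and none elsewhere.
Then 2 deg B + 5 ≤ 2 is impossible and deg A ≤ 1. -/
theorem smul_mem_regularDifferentials_iff [IsAlgClosed K] (h : IsModel g G w x y u V) (φ : F) :
    φ • IsChart.invariantDifferential K u V ∈ regularDifferentials K F ↔
      ∃ a b : K, φ = algebraMap K F a + algebraMap K F b * u := by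
  have hinf : φ • IsChart.invariantDifferential K u V ∈ Submodule.span h.infinity.1.integer
      (Set.range fun b : h.infinity.1.integer => KaehlerDifferential.D K F (b : F)) ↔
      h.infinity.1 φ ≤ WithZero.exp (2 : ℤ) := by
    rw [h.invariantDifferential_eq, smul_smul,
      h.chart.smul_invariantDifferential_mem_span_iff h.isPoint h.infinity_isAt, map_mul,
      Valuation.map_neg, h.infinity_sub]
    rw [show (-2 : ℤ) = -(2 : ℤ) from rfl, WithZero.exp_neg, ← div_eq_mul_inv,
      div_le_one₀ WithZero.exp_pos]
  constructor
  · intro hmem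
    obtain ⟨A, B, rfl, hA, hB⟩ := h.exists_polyFn_of_pole_le (φ := φ) (m := 2)
      (fun P r s hs hat => (h.chart'.smul_invariantDifferential_mem_span_iff (h.sep.isPoint hs)
        hat φ).1 (hmem P)) (hinf.1 (hmem h.infinity))
    have hB0 : B = 0 := by
      by_contra hB0
      have := hB hB0
      omega
    have hA1 : A.natDegree ≤ 1 := by
      by_cases hA0 : A = 0
      · simp [hA0]
      · have := hA hA0
        omega
    obtain ⟨b, a, rfl⟩ := exists_eq_X_add_C_of_natDegree_le_one hA1
    refine ⟨a, b, ?_⟩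
    simp [polyFn, hB0]
    ring
  · rintro ⟨a, b, rfl⟩ P
    rcases h.eq_infinity_or_isAt P with rfl | ⟨r, s, hs, hat⟩
    · rw [hinf]
      refine h.infinity.1.map_add_le ((h.infinity.map_const_le_one a).trans ?_) ?_
      · rw [← WithZero.exp_zero, WithZero.exp_le_exp]
        norm_num
      · rw [map_mul, h.infinity_u]
        exact mul_le_of_le_one_left' (h.infinity.map_const_le_one b)
    · rw [h.chart'.smul_invariantDifferential_mem_span_iff (h.sep.isPoint hs) hat]
      refine P.1.map_add_le (P.map_const_le_one a) ?_
      rw [map_mul]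
      exact mul_le_one' (P.map_const_le_one b) (Place.map_le_one_of_sub hat.left)

/-- The genus of a model is `2`: the regular differentials are spanned by `du/V` and `u du/V`. -/
theorem curveGenus_eq_two [IsAlgClosed K] (h : IsModel g G w x y u V) : curveGenus K F = 2 := by
  set ω := IsChart.invariantDifferential K u V with hω
  have hω0 : ω ≠ 0 := h.chart'.invariantDifferential_ne_zero
  have hmem : ∀ φ : F, φ • ω ∈ regularDifferentials K F ↔ _ := h.smul_mem_regularDifferentials_iff
  let f : K × K →ₗ[K] Ω[F⁄K] :=
    { toFun := fun p => (algebraMap K F p.1 + algebraMap K F p.2 * u) • ω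
      map_add' := fun p q => by
        rw [← add_smul]
        congr 1
        simp only [Prod.fst_add, Prod.snd_add, map_add]
        ring
      map_smul' := fun c p => by
        rw [RingHom.id_apply]
        conv_rhs => rw [← algebraMap_smul F c, smul_smul]
        congr 1
        simp only [Prod.smul_fst, Prod.smul_snd, smul_eq_mul, map_mul]
        ring }
  have hinj : Function.Injective f := by
    rw [← LinearMap.ker_eq_bot, LinearMap.ker_eq_bot']
    rintro ⟨a, b⟩ h0
    have h1 : algebraMap K F a + algebraMap K F b * u = 0 := (smul_eq_zero.1 h0).resolve_right hω0
    have h2 : Polynomial.C a + Polynomial.C b * X = 0 := by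
      apply (transcendental_iff.1 h.chart'.transcendental)
      simpa using h1
    have h3 := congrArg (fun p => coeff p 0) h2
    have h4 := congrArg (fun p => coeff p 1) h2
    simp at h3 h4
    rw [h3, h4]
    rfl
  have hrange : LinearMap.range f = regularDifferentials K F := by
    ext η
    obtain ⟨c, rfl⟩ := h.chart'.exists_eq_smul η
    rw [← hω, hmem c, LinearMap.mem_range]
    constructor
    · rintro ⟨⟨a, b⟩, e⟩
      exact ⟨a, b, (smul_left_injective F hω0 e).symm⟩
    · rintro ⟨a, b, rfl⟩
      exact ⟨(a, b), rfl⟩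
  rw [curveGenus, ← hrange, LinearMap.finrank_range_of_inj hinj]
  simp

end IsModel

end Differentials

/-! ## Divisors in Mumford representation -/

section Mumford

variable {K F : Type} [Field K] [Field F] [Algebra K F]

/-- `(a, b)` is the Mumford representation of an effective divisor on `V² = G(u)` which avoids the
Weierstrass points. -/
structure IsMumfordPair (G a b : K[X]) : Prop where
  ne_zero : a ≠ 0
  dvd : a ∣ G - b ^ 2
  coprime : IsCoprime a G

theorem IsMumfordPair.sq {G a b : K[X]} (h : IsMumfordPair G a b) {r : K} (hr : a.IsRoot r) :
    b.eval r ^ 2 = G.eval r := by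
  have h1 := hr.dvd h.dvd
  rw [IsRoot, eval_sub, eval_pow] at h1
  exact (sub_eq_zero.1 h1).symm

theorem eval_ne_zero_of_isCoprime {a G : K[X]} (h : IsCoprime a G) {r : K} (hr : a.IsRoot r) :
    G.eval r ≠ 0 := by
  obtain ⟨s, t, e⟩ := h
  intro h0
  have h1 := congrArg (eval r) e
  rw [eval_add, eval_mul, eval_mul, hr.eq_zero, h0] at h1
  simp at h1

theorem IsMumfordPair.eval_ne_zero {G a b : K[X]} (h : IsMumfordPair G a b) {r : K}
    (hr : a.IsRoot r) : b.eval r ≠ 0 := by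
  intro h0
  have := h.sq hr
  rw [h0] at this
  exact eval_ne_zero_of_isCoprime h.coprime hr (by rw [← this]; simp)

theorem Place.map_eq_exp_neg_ord (P : Place K F) (u : Fˣ) :
    P.1 (u : F) = WithZero.exp (-P.ord u) := by
  rw [Place.ord, neg_neg, WithZero.exp_log]
  exact (Valuation.ne_zero_iff _).2 u.ne_zero

theorem Place.ord_eq_of_map_eq (P : Place K F) {u : Fˣ} {n : ℤ}
    (h : P.1 (u : F) = WithZero.exp (-n)) : P.ord u = n := by
  rw [Place.ord, h, WithZero.log_exp, neg_neg]

namespace IsModel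

variable [CharZero K] {g G : K[X]} {w : K} {x y u V : F}

open Classical in
/-- The place at the point `(r, s)` of the second chart. -/
def pointPlace (h : IsModel g G w x y u V) (r s : K) : Place K F :=
  if hP : ∃ P : Place K F, P.IsAt u V r s then hP.choose else h.infinity

theorem pointPlace_isAt (h : IsModel g G w x y u V) {r s : K} (hs : s ^ 2 = G.eval r) :
    (h.pointPlace r s).IsAt u V r s := by
  have hP := h.chart'.exists_isAt (h.sep.isPoint hs)
  rw [pointPlace, dif_pos hP]
  exact hP.choose_spec

open Classical in
/-- The divisor of degree `0` with Mumford representation `(a, b)`. -/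
def mumfordDivisor (h : IsModel g G w x y u V) (a b : K[X]) : CurveDivisor K F :=
  ∑ r ∈ a.roots.toFinset, Finsupp.single (h.pointPlace r (b.eval r)) (rootMultiplicity r a : ℤ) -
    Finsupp.single h.infinity (a.natDegree : ℤ)

/-- Over an algebraically closed field a has as many roots, with multiplicity, as its degree. -/
theorem divisorDegree_mumfordDivisor [IsAlgClosed K] (h : IsModel g G w x y u V) (a b : K[X]) :
    divisorDegree K F (h.mumfordDivisor a b) = 0 := by
  classical
  rw [mumfordDivisor, map_sub, map_sum]
  simp only [divisorDegree, Finsupp.liftAddHom_apply_single, AddMonoidHom.id_apply]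
  rw [← Nat.cast_sum, sub_eq_zero, Nat.cast_inj]
  simp only [← count_roots]
  rw [Multiset.toFinset_sum_count_eq, ← splits_iff_card_roots.1 (IsAlgClosed.splits a)]

variable {a b : K[X]}

theorem mumfordDivisor_infinity (h : IsModel g G w x y u V) (hab : IsMumfordPair G a b) :
    h.mumfordDivisor a b h.infinity = -(a.natDegree : ℤ) := by
  classical
  rw [mumfordDivisor, Finsupp.sub_apply, Finsupp.finsetSum_apply, Finset.sum_eq_zero]
  · simp
  · intro r hr
    rw [Multiset.mem_toFinset, mem_roots hab.ne_zero] at hr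
    rw [Finsupp.single_eq_of_ne]
    intro e
    have := h.pointPlace_isAt (hab.sq hr)
    rw [← e] at this
    exact h.not_infinity_isAt this

theorem mumfordDivisor_apply_of_eq (h : IsModel g G w x y u V) (hab : IsMumfordPair G a b)
    {P : Place K F} {r : K} (hat : P.IsAt u V r (b.eval r)) :
    h.mumfordDivisor a b P = rootMultiplicity r a := by
  classical
  have hinf : h.infinity ≠ P := by
    rintro rfl
    exact h.not_infinity_isAt hat
  rw [mumfordDivisor, Finsupp.sub_apply, Finsupp.finsetSum_apply,
    Finsupp.single_eq_of_ne hinf.symm, sub_zero, Finset.sum_eq_single r]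
  · by_cases hr : a.IsRoot r
    · rw [(h.pointPlace_isAt (hab.sq hr)).unique h.chart' (h.sep.isPoint (hab.sq hr)) hat,
        Finsupp.single_eq_same]
    · simp [rootMultiplicity_eq_zero hr]
  · intro t ht htr
    rw [Multiset.mem_toFinset, mem_roots hab.ne_zero] at ht
    rw [Finsupp.single_eq_of_ne]
    rintro rfl
    exact htr (Place.eq_of_map_sub_lt_one (h.pointPlace_isAt (hab.sq ht)).left hat.left)
  · intro hr
    rw [Multiset.mem_toFinset, mem_roots hab.ne_zero] at hr
    simp [rootMultiplicity_eq_zero hr]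

theorem mumfordDivisor_apply_of_ne (h : IsModel g G w x y u V) (hab : IsMumfordPair G a b)
    {P : Place K F} {r s : K} (hat : P.IsAt u V r s) (hs : s ≠ b.eval r) :
    h.mumfordDivisor a b P = 0 := by
  classical
  have hinf : h.infinity ≠ P := by
    rintro rfl
    exact h.not_infinity_isAt hat
  rw [mumfordDivisor, Finsupp.sub_apply, Finsupp.finsetSum_apply,
    Finsupp.single_eq_of_ne hinf.symm, sub_zero, Finset.sum_eq_zero]
  intro t ht
  rw [Multiset.mem_toFinset, mem_roots hab.ne_zero] at ht
  rw [Finsupp.single_eq_of_ne]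
  rintro rfl
  have h1 := h.pointPlace_isAt (hab.sq ht)
  obtain rfl := Place.eq_of_map_sub_lt_one h1.left hat.left
  exact hs (Place.eq_of_map_sub_lt_one h1.right hat.right).symm

/-- A function `A(u) + B(u) V` of norm `c aⁿ` that vanishes on the divisor of `(a, b)` shows that
`n` times its class is trivial. -/
theorem nsmul_mumfordDivisor_mem_principalDivisors [IsAlgClosed K] (h : IsModel g G w x y u V)
    (hab : IsMumfordPair G a b) {A B : K[X]} {n : ℕ} {c : K} (hc : c ≠ 0)
    (hnorm : A ^ 2 - B ^ 2 * G = Polynomial.C c * a ^ n) (hdvd : a ∣ A + B * b)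
    (hB : IsCoprime a B) : n • h.mumfordDivisor a b ∈ principalDivisors K F := by
  have hN : Polynomial.C c * a ^ n ≠ 0 := mul_ne_zero (by simpa) (pow_ne_zero n hab.ne_zero)
  have hmul := h.chart'.polyFn_mul_conj A B
  rw [hnorm] at hmul
  have hφ : polyFn u V A B ≠ 0 :=
    left_ne_zero_of_mul (hmul ▸ h.chart'.aeval_ne_zero hN)
  have hval : ∀ P : Place K F, P.1 (polyFn u V A B) * P.1 (polyFn u V A (-B)) =
      P.1 (aeval u a) ^ n := by
    intro P
    rw [← map_mul, hmul, map_mul, map_mul, aeval_C, P.2.2 c hc, one_mul, map_pow, map_pow]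
  refine ⟨Units.mk0 _ hφ, fun P => (P.ord_eq_of_map_eq ?_).symm⟩
  rw [Units.val_mk0, Finsupp.smul_apply, nsmul_eq_mul]
  rcases h.eq_infinity_or_isAt P with rfl | ⟨r, s, hs, hat⟩
  -- By parity the two terms do not cancel, so the function and its conjugate have equal pole orders
  -- at infinity; each is half that of the norm.
  · have hconj : h.infinity.1 (polyFn u V A (-B)) = h.infinity.1 (polyFn u V A B) := by
      by_cases hA : A = 0
      · simp [polyFn, hA]
      by_cases hB : B = 0
      · simp [polyFn, hB]
      have hne : h.infinity.1 (aeval u A) ≠ h.infinity.1 (aeval u B * V) := by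
        rw [map_mul, h.infinity_aeval hB, h.infinity_V, ← WithZero.exp_add, h.infinity_aeval hA,
          Ne, WithZero.exp_inj]
        omega
      rw [polyFn, polyFn, Valuation.map_add_of_distinct_val _ hne,
        Valuation.map_add_of_distinct_val, map_neg, neg_mul, Valuation.map_neg]
      rw [map_neg, neg_mul, Valuation.map_neg]
      exact hne
    have h1 := hval h.infinity
    rw [hconj, h.infinity_aeval hab.ne_zero, ← WithZero.exp_nsmul] at h1
    rw [h.mumfordDivisor_infinity hab]
    have h2 : h.infinity.1 (polyFn u V A B) ≠ 0 := (Valuation.ne_zero_iff _).2 hφ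
    rw [← WithZero.exp_log h2, ← WithZero.exp_add, WithZero.exp_inj] at h1
    rw [← WithZero.exp_log h2, WithZero.exp_inj]
    rw [nsmul_eq_mul] at h1
    linarith
  by_cases hr : a.IsRoot r
  swap
  · have h0 : h.mumfordDivisor a b P = 0 := by
      by_cases hsb : s = b.eval r
      · subst hsb
        rw [h.mumfordDivisor_apply_of_eq hab hat, rootMultiplicity_eq_zero hr]
        rfl
      · exact h.mumfordDivisor_apply_of_ne hab hat hsb
    have h1 : P.1 (aeval u a) = 1 := by
      rw [← polyFn_zero_right u V]
      exact hat.map_polyFn_eq_one (by simpa [polyVal] using hr)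
    have h2 := hval P
    rw [h1, one_pow] at h2
    rw [h0, mul_zero, neg_zero, WithZero.exp_zero]
    have h3 := hat.map_polyFn_le_one A B
    have h4 := hat.map_polyFn_le_one A (-B)
    exact le_antisymm h3 (h2.ge.trans (mul_le_of_le_one_right' h4))
  have hbr := hab.eval_ne_zero hr
  have hsq := hab.sq hr
  have hBr := eval_ne_zero_of_isCoprime hB hr
  have hAB : A.eval r = -(B.eval r * b.eval r) := by
    have := (hr.dvd hdvd).eq_zero
    rw [eval_add, eval_mul] at this
    linear_combination this
  -- As A(r) = -B(r)b(r), both the conjugate at (r, b(r)) and the function itself at (r, -b(r)) take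
  -- the value -2B(r)b(r) ≠ 0. The whole zero of the norm over r therefore belongs to the function
  -- at (r, b(r)).
  have htwo : B.eval r * b.eval r ≠ -(B.eval r * b.eval r) := by
    intro e
    have : (2 : K) * (B.eval r * b.eval r) = 0 := by linear_combination e
    simp [hBr, hbr] at this
  by_cases hsb : s = b.eval r
  · subst hsb
    rw [h.mumfordDivisor_apply_of_eq hab hat]
    have h1 : P.1 (polyFn u V A (-B)) = 1 := by
      refine hat.map_polyFn_eq_one fun h0 => htwo ?_
      rw [polyVal, hAB, eval_neg] at h0
      linear_combination -h0
    have h2 := hval P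
    rw [h1, mul_one, hat.map_aeval_of_ne_zero h.chart' (h.sep.isPoint hs) hbr hab.ne_zero,
      ← WithZero.exp_nsmul] at h2
    rw [h2, nsmul_eq_mul]
    congr 1
    ring
  · rw [h.mumfordDivisor_apply_of_ne hab hat hsb, mul_zero, neg_zero, WithZero.exp_zero]
    have hs' : s = -b.eval r := by
      have : (s - b.eval r) * (s + b.eval r) = 0 := by linear_combination hs - hsq
      rcases mul_eq_zero.1 this with h0 | h0
      · exact absurd (sub_eq_zero.1 h0) hsb
      · exact eq_neg_of_add_eq_zero_left h0
    refine hat.map_polyFn_eq_one fun h0 => htwo ?_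
    rw [polyVal, hAB, hs'] at h0
    linear_combination -h0

/-- A nonzero multiple of small degree of a Mumford divisor is not principal. -/
theorem nsmul_mumfordDivisor_notMem_principalDivisors [IsAlgClosed K]
    (h : IsModel g G w x y u V) (hab : IsMumfordPair G a b) {m : ℕ} (hm : m ≠ 0)
    (ha : a.natDegree ≠ 0) (hma : m * a.natDegree ≤ 4) :
    m • h.mumfordDivisor a b ∉ principalDivisors K F := by
  rintro ⟨φ, hφ⟩
  have hval : ∀ P : Place K F, P.1 (φ : F) = WithZero.exp (-(m * h.mumfordDivisor a b P)) := by
    intro P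
    rw [P.map_eq_exp_neg_ord, ← hφ P, Finsupp.smul_apply, nsmul_eq_mul]
  -- A pole of order at most 4 is below the pole order 5 of V, so the function involves u alone.
  obtain ⟨A, B, e, -, hB⟩ := h.exists_polyFn_of_pole_le (φ := (φ : F)) (m := 4) (by
    intro P r s hs hat
    rw [hval, ← WithZero.exp_zero, WithZero.exp_le_exp]
    by_cases hsb : s = b.eval r
    · subst hsb
      rw [h.mumfordDivisor_apply_of_eq hab hat]
      simp only [Left.neg_nonpos_iff]
      positivity
    · rw [h.mumfordDivisor_apply_of_ne hab hat hsb, mul_zero, neg_zero]) (by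
    rw [hval, h.mumfordDivisor_infinity hab, WithZero.exp_le_exp]
    have : (m : ℤ) * a.natDegree ≤ 4 := by exact_mod_cast hma
    linarith)
  obtain rfl : B = 0 := by
    by_contra h0
    have := hB h0
    omega
  obtain ⟨r, hr⟩ := IsAlgClosed.exists_root a
    (fun h0 => ha (natDegree_eq_zero_iff_degree_le_zero.2 h0.le))
  have hsq := hab.sq hr
  have hbr := hab.eval_ne_zero hr
  have hat := h.pointPlace_isAt hsq
  have hlt : (h.pointPlace r (b.eval r)).1 (φ : F) < 1 := by
    rw [hval, h.mumfordDivisor_apply_of_eq hab hat, ← WithZero.exp_zero, WithZero.exp_lt_exp]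
    have h1 := (rootMultiplicity_pos hab.ne_zero).2 hr
    have h2 : (0 : ℤ) < m * rootMultiplicity r a := by
      have := Nat.mul_pos (Nat.pos_of_ne_zero hm) h1
      exact_mod_cast this
    linarith
  rw [e] at hlt
  have hA := hat.polyVal_eq_zero hlt
  -- A polynomial in u takes the same value at the conjugate point (r, -b(r)). That point differs
  -- from (r, b(r)) and is outside the support of the divisor.
  have hsq' : (-b.eval r) ^ 2 = G.eval r := by rw [neg_sq, hsq]
  have hat' := h.pointPlace_isAt hsq'
  have hA' : polyVal r (-b.eval r) A 0 = 0 := by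
    simpa [polyVal] using hA
  have hlt' := hat'.map_polyFn_lt_one hA'
  rw [← e, hval, h.mumfordDivisor_apply_of_ne hab hat' (fun h0 => ?_), mul_zero, neg_zero,
    WithZero.exp_zero] at hlt'
  · exact lt_irrefl _ hlt'
  · have : (2 : K) * b.eval r = 0 := by linear_combination -h0
    simp [hbr] at this

end IsModel

/-! ### Galois action -/

namespace Place

theorem IsAt.map {σ : K ≃+* K} {e : F ≃+* F}
    (he : ∀ c, e (algebraMap K F c) = algebraMap K F (σ c)) {P : Place K F} {x y : F} {r s : K}
    (hx : e x = x) (hy : e y = y) (hat : P.IsAt x y r s) :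
    (P.map σ e he).IsAt x y (σ r) (σ s) := by
  have key : ∀ (z : F) (t : K), e z = z →
      (P.map σ e he).1 (z - algebraMap K F (σ t)) = P.1 (z - algebraMap K F t) := by
    intro z t hz
    have : z - algebraMap K F (σ t) = e (z - algebraMap K F t) := by rw [map_sub, hz, he]
    rw [this]
    exact congrArg P.1 (e.symm_apply_apply _)
  exact ⟨(key x r hx).trans_lt hat.left, (key y s hy).trans_lt hat.right⟩

end Place

namespace IsModel

variable [CharZero K] {g G : K[X]} {w : K} {x y u V : F}

/-- The automorphism fixes u, V and the place at infinity because it fixes x, y and w. It permutes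
the roots of a with their multiplicities, and b commutes with it. -/
theorem divisorMap_mumfordDivisor (h : IsModel g G w x y u V) {a b : K[X]}
    (hab : IsMumfordPair G a b) {σ : K ≃+* K} {e : F ≃+* F}
    (he : ∀ c, e (algebraMap K F c) = algebraMap K F (σ c)) (hx : e x = x) (hy : e y = y)
    (hw : σ w = w) (ha : a.map (σ : K →+* K) = a) (hb : b.map (σ : K →+* K) = b) :
    divisorMap σ e he (h.mumfordDivisor a b) = h.mumfordDivisor a b := by
  classical
  have hx0 : x - algebraMap K F w ≠ 0 := right_ne_zero_of_mul_eq_one h.u_mul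
  have hu : e u = u := by
    apply mul_right_cancel₀ hx0
    have := congrArg e h.u_mul
    rwa [map_mul, map_sub, hx, he, hw, map_one, ← h.u_mul] at this
  have hV : e V = V := by
    apply mul_right_cancel₀ (pow_ne_zero 3 hx0)
    have := congrArg e h.V_mul
    rwa [map_mul, map_pow, map_sub, hx, he, hw, hy, ← h.V_mul] at this
  have hinf : h.infinity.map σ e he = h.infinity := by
    have h1 := h.infinity_isAt.map he hx hy
    rw [hw, map_zero] at h1
    exact h1.unique h.chart h.isPoint h.infinity_isAt
  have hev : ∀ r, b.eval (σ r) = σ (b.eval r) := by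
    intro r
    conv_lhs => rw [← hb]
    exact eval_map_apply (σ : K →+* K) r
  have hroot : ∀ r, a.IsRoot r → a.IsRoot (σ r) := by
    intro r hr
    have : a.eval (σ r) = σ (a.eval r) := by
      conv_lhs => rw [← ha]
      exact eval_map_apply (σ : K →+* K) r
    rw [IsRoot, this, hr.eq_zero, map_zero]
  have hmult : ∀ r, rootMultiplicity (σ r) a = rootMultiplicity r a := by
    intro r
    conv_lhs => rw [← ha]
    exact (eq_rootMultiplicity_map (f := (σ : K →+* K)) σ.injective r).symm
  have hpt : ∀ r, a.IsRoot r → (h.pointPlace r (b.eval r)).map σ e he =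
      h.pointPlace (σ r) (b.eval (σ r)) := by
    intro r hr
    have h1 := (h.pointPlace_isAt (hab.sq hr)).map he hu hV
    rw [← hev] at h1
    have hsq := hab.sq (hroot r hr)
    exact h1.unique h.chart' (h.sep.isPoint hsq) (h.pointPlace_isAt hsq)
  rw [mumfordDivisor, map_sub, map_sum]
  congr 1
  · have h1 : ∀ r ∈ a.roots.toFinset, divisorMap σ e he
        (Finsupp.single (h.pointPlace r (b.eval r)) (rootMultiplicity r a : ℤ)) =
        Finsupp.single (h.pointPlace (σ r) (b.eval (σ r))) (rootMultiplicity (σ r) a : ℤ) := by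
      intro r hr
      rw [Multiset.mem_toFinset, mem_roots hab.ne_zero] at hr
      rw [← hpt r hr, hmult]
      exact Finsupp.mapDomain_single
    rw [Finset.sum_congr rfl h1]
    have hsurj : a.roots.toFinset.image σ = a.roots.toFinset := by
      apply Finset.eq_of_subset_of_card_le
      · intro t ht
        obtain ⟨r, hr, rfl⟩ := Finset.mem_image.1 ht
        rw [Multiset.mem_toFinset, mem_roots hab.ne_zero] at hr ⊢
        exact hroot r hr
      · rw [Finset.card_image_of_injective _ σ.injective]
    conv_rhs => rw [← hsurj]
    rw [Finset.sum_image σ.injective.injOn]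
  · conv_rhs => rw [← hinf]
    exact Finsupp.mapDomain_single

end IsModel

end Mumford

/-! ## The function field of `y² + h(x) y = f(x)` -/

namespace HyperellipticEquation

section ChartAtOrigin

open IntermediateField

variable (C : HyperellipticEquation)

/-- The polynomial `h² + 4 f`, over the algebraic closure. -/
def disc : Qbar[X] := (C.h ^ 2 + 4 * C.f).map (algebraMap ℚ Qbar)

theorem algebraMap_disc : algebraMap Qbar[X] (RatFunc Qbar) C.disc =
    toRatFunc C.h ^ 2 + 4 * toRatFunc C.f := by
  simp [disc, toRatFunc, map_ofNat]

theorem poly_eq : C.poly = X ^ 2 + (Polynomial.C (toRatFunc C.h) * X +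
    Polynomial.C (-toRatFunc C.f)) := by
  rw [poly, Polynomial.C_neg]
  ring

theorem natDegree_poly : C.poly.natDegree = 2 := by
  rw [poly_eq]
  compute_degree!

theorem monic_poly : C.poly.Monic := by
  rw [poly_eq]
  monicity!

/-- A quadratic is reducible only if it has a root, and then its discriminant is a square in
Qbar(x); a simple root of the discriminant excludes this. -/
theorem irreducible_poly {w : Qbar} (hw : C.disc.eval w = 0)
    (hw' : (derivative C.disc).eval w ≠ 0) : Irreducible C.poly := by
  rw [C.monic_poly.irreducible_iff_roots_eq_zero_of_degree_le_three C.natDegree_poly.ge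
    (by rw [natDegree_poly]; norm_num)]
  by_contra hne
  obtain ⟨t, ht⟩ := Multiset.exists_mem_of_ne_zero hne
  rw [mem_roots C.monic_poly.ne_zero, IsRoot, poly] at ht
  simp only [eval_sub, eval_add, eval_pow, eval_X, eval_mul, eval_C] at ht
  have hsq : (2 * t + toRatFunc C.h) ^ 2 = algebraMap Qbar[X] (RatFunc Qbar) C.disc := by
    rw [algebraMap_disc]
    linear_combination 4 * ht
  -- The square root is integral over Qbar[x], hence a polynomial p, and every root of p² is
  -- multiple.
  obtain ⟨p, hp⟩ := IsIntegrallyClosed.exists_algebraMap_eq_of_isIntegral_pow (R := Qbar[X])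
    (x := 2 * t + toRatFunc C.h) two_pos (hsq ▸ isIntegral_algebraMap)
  rw [← hp, ← map_pow] at hsq
  have hd : p ^ 2 = C.disc := RatFunc.algebraMap_injective Qbar hsq
  rw [← hd] at hw hw'
  have hpw : p.eval w = 0 := by simpa using hw
  simp [derivative_pow, hpw] at hw'

/-- The coordinate `x` as an element of the function field. -/
def xCoord : C.FunctionField := AdjoinRoot.of C.poly RatFunc.X

/-- The function `2 y + h(x)`. -/
def yCoord : C.FunctionField := 2 * AdjoinRoot.root C.poly + AdjoinRoot.of C.poly (toRatFunc C.h)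

theorem algebraMap_functionField (c : Qbar) : algebraMap Qbar C.FunctionField c =
    AdjoinRoot.of C.poly (algebraMap Qbar (RatFunc Qbar) c) := rfl

theorem galoisFunctionField_xCoord (σ : Qbar ≃ₐ[ℚ] Qbar) :
    C.galoisFunctionField σ C.xCoord = C.xCoord := by
  have := galoisRatFunc_algebraMap σ X
  rw [map_X, RatFunc.algebraMap_X] at this
  rw [xCoord, galoisFunctionField, AdjoinRoot.coe_mapRingEquiv, AdjoinRoot.map_of]
  exact congrArg _ this

theorem galoisFunctionField_yCoord (σ : Qbar ≃ₐ[ℚ] Qbar) :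
    C.galoisFunctionField σ C.yCoord = C.yCoord := by
  rw [yCoord, map_add, map_mul, map_ofNat, galoisFunctionField_root]
  congr 1
  rw [galoisFunctionField, AdjoinRoot.coe_mapRingEquiv, AdjoinRoot.map_of]
  exact congrArg _ (galoisRatFunc_toRatFunc σ _)

variable [Fact (Irreducible C.poly)]

theorem aeval_xCoord (p : Qbar[X]) :
    aeval C.xCoord p = AdjoinRoot.of C.poly (algebraMap Qbar[X] (RatFunc Qbar) p) := by
  induction p using Polynomial.induction_on' with
  | add p q hp hq => rw [map_add, map_add, map_add, hp, hq]
  | monomial n a =>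
    rw [aeval_monomial, algebraMap_functionField, xCoord, ← C_mul_X_pow_eq_monomial, map_mul,
      map_mul, map_pow, map_pow, RatFunc.algebraMap_X, RatFunc.algebraMap_C]
    rfl

theorem of_mem_adjoin (q : RatFunc Qbar) : AdjoinRoot.of C.poly q ∈ Qbar⟮C.xCoord⟯ := by
  rw [mem_adjoin_simple_iff]
  refine ⟨q.num, q.denom, ?_⟩
  rw [aeval_xCoord, aeval_xCoord, ← map_div₀, RatFunc.num_div_denom]

theorem exists_of_eq {z : C.FunctionField} (hz : z ∈ Qbar⟮C.xCoord⟯) :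
    ∃ q, AdjoinRoot.of C.poly q = z := by
  obtain ⟨a, b, rfl⟩ := (mem_adjoin_simple_iff _ _).1 hz
  exact ⟨_, by rw [aeval_xCoord, aeval_xCoord, ← map_div₀]⟩

theorem yCoord_sq : C.yCoord ^ 2 = aeval C.xCoord C.disc := by
  have h : AdjoinRoot.root C.poly ^ 2 + AdjoinRoot.of C.poly (toRatFunc C.h) *
      AdjoinRoot.root C.poly - AdjoinRoot.of C.poly (toRatFunc C.f) = 0 := by
    have h1 : eval₂ (AdjoinRoot.of C.poly) (AdjoinRoot.root C.poly)
        (X ^ 2 + Polynomial.C (toRatFunc C.h) * X - Polynomial.C (toRatFunc C.f)) = 0 :=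
      AdjoinRoot.eval₂_root C.poly
    simpa only [eval₂_sub, eval₂_add, eval₂_mul, eval₂_pow, eval₂_X, eval₂_C] using h1
  rw [aeval_xCoord, algebraMap_disc, yCoord, map_add, map_mul, map_pow, map_ofNat]
  linear_combination 4 * h

theorem charZero_functionField : CharZero C.FunctionField :=
  charZero_of_injective_algebraMap (algebraMap Qbar C.FunctionField).injective

theorem isChart : IsChart C.disc C.xCoord C.yCoord := by
  have := C.charZero_functionField
  have h2 : AdjoinRoot.of C.poly 2⁻¹ = 2⁻¹ := by rw [map_inv₀, map_ofNat]
  refine ⟨?_, C.yCoord_sq, ?_, ?_⟩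
  · rw [transcendental_iff]
    intro p hp
    rw [aeval_xCoord, map_eq_zero] at hp
    exact (map_eq_zero_iff _ (RatFunc.algebraMap_injective Qbar)).1 hp
  · intro hy
    obtain ⟨q, hq⟩ := C.exists_of_eq hy
    -- If 2y + h were rational, the root y would satisfy a linear equation over Qbar(x), too small a
    -- degree for a multiple of the quadratic.
    have h1 : AdjoinRoot.mk C.poly (X - Polynomial.C (2⁻¹ * (q - toRatFunc C.h))) = 0 := by
      rw [map_sub, AdjoinRoot.mk_X, AdjoinRoot.mk_C, map_mul, map_sub, hq, h2, yCoord]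
      field_simp
      ring
    rw [AdjoinRoot.mk_eq_zero] at h1
    have := natDegree_le_of_dvd h1 (X_sub_C_ne_zero _)
    rw [natDegree_poly, natDegree_X_sub_C] at this
    omega
  · intro z
    obtain ⟨p, rfl⟩ := AdjoinRoot.mk_surjective z
    have hdeg : (p %ₘ C.poly).natDegree ≤ 1 := by
      have := natDegree_modByMonic_lt p C.monic_poly (fun h => by
        have := C.natDegree_poly
        rw [h, natDegree_one] at this
        omega)
      rw [natDegree_poly] at this
      omega
    obtain ⟨a, b, hab⟩ := exists_eq_X_add_C_of_natDegree_le_one hdeg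
    have hp : AdjoinRoot.mk C.poly p = AdjoinRoot.of C.poly a * AdjoinRoot.root C.poly +
        AdjoinRoot.of C.poly b := by
      conv_lhs => rw [← modByMonic_add_div p C.poly, hab]
      simp
    refine ⟨AdjoinRoot.of C.poly (b - 2⁻¹ * a * toRatFunc C.h), C.of_mem_adjoin _,
      AdjoinRoot.of C.poly (2⁻¹ * a), C.of_mem_adjoin _, ?_⟩
    rw [hp, yCoord]
    simp only [map_sub, map_mul, h2]
    field_simp
    ring

end ChartAtOrigin

/-! ## Certificates for torsion classes -/

/-- The quintic with coefficients `c₀, …, c₅`. -/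
def quintic (c₀ c₁ c₂ c₃ c₄ c₅ : ℚ) : ℚ[X] :=
  Polynomial.C c₅ * X ^ 5 + Polynomial.C c₄ * X ^ 4 + Polynomial.C c₃ * X ^ 3 +
    Polynomial.C c₂ * X ^ 2 + Polynomial.C c₁ * X + Polynomial.C c₀

/-- The sextic `(x - w)⁶ q(1 / (x - w))`, for the quintic `q` with coefficients `c₀, …, c₅`. -/
def sextic (w c₀ c₁ c₂ c₃ c₄ c₅ : ℚ) : ℚ[X] :=
  Polynomial.C c₀ * (X - Polynomial.C w) ^ 6 + Polynomial.C c₁ * (X - Polynomial.C w) ^ 5 +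
    Polynomial.C c₂ * (X - Polynomial.C w) ^ 4 + Polynomial.C c₃ * (X - Polynomial.C w) ^ 3 +
    Polynomial.C c₄ * (X - Polynomial.C w) ^ 2 + Polynomial.C c₅ * (X - Polynomial.C w)

theorem natDegree_quintic {c₀ c₁ c₂ c₃ c₄ c₅ : ℚ} (h : c₅ ≠ 0) :
    (quintic c₀ c₁ c₂ c₃ c₄ c₅).natDegree = 5 := by
  unfold quintic
  compute_degree!

/-- `(a, b)` is a Mumford pair on `V² = G(u)`, of degree at most `2`, and `A + B V` is a function
that kills `n` times its class. -/
structure IsTorsionCertificate (G : ℚ[X]) (n : ℕ) (a b A B : ℚ[X]) : Prop where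
  natDegree_ne_zero : a.natDegree ≠ 0
  natDegree_le : a.natDegree ≤ 2
  pair : IsMumfordPair G a b
  norm : ∃ c : ℚ, c ≠ 0 ∧ A ^ 2 - B ^ 2 * G = Polynomial.C c * a ^ n
  dvd : a ∣ A + B * b
  coprime : IsCoprime a B

section Torsion

variable {C : HyperellipticEquation}

/-- Dividing Y² = g(x) by (x - w)⁶ turns the expansion of g at w into the quintic in u with reversed
coefficients. Its leading coefficient c₅ is g'(w), so c₅ ≠ 0 says that w is a simple root. -/
theorem exists_isModel {w c₀ c₁ c₂ c₃ c₄ c₅ : ℚ} (hc : c₅ ≠ 0)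
    (hC : C.h ^ 2 + 4 * C.f = sextic w c₀ c₁ c₂ c₃ c₄ c₅)
    (hsep : (quintic c₀ c₁ c₂ c₃ c₄ c₅).Separable) :
    ∃ _ : Fact (Irreducible C.poly), ∃ u V : C.FunctionField,
      IsModel C.disc ((quintic c₀ c₁ c₂ c₃ c₄ c₅).map (algebraMap ℚ Qbar))
        (algebraMap ℚ Qbar w) C.xCoord C.yCoord u V := by
  have hw : C.disc.eval (algebraMap ℚ Qbar w) = 0 := by
    rw [disc, hC, eval_map_algebraMap, aeval_algebraMap_apply]
    simp [sextic]
  have hw' : (derivative C.disc).eval (algebraMap ℚ Qbar w) ≠ 0 := by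
    rw [disc, hC, derivative_map, eval_map_algebraMap, aeval_algebraMap_apply]
    simpa [sextic, derivative_pow] using hc
  have hirr : Fact (Irreducible C.poly) := ⟨C.irreducible_poly hw hw'⟩
  set w' := algebraMap ℚ Qbar w with hw'_def
  have hx0 : C.xCoord - algebraMap Qbar C.FunctionField w' ≠ 0 := by
    have := C.isChart.aeval_ne_zero (X_sub_C_ne_zero w')
    simpa using this
  set t := C.xCoord - algebraMap Qbar C.FunctionField w' with ht
  have hu : t⁻¹ * t = 1 := inv_mul_cancel₀ hx0
  have hV : C.yCoord * t⁻¹ ^ 3 * t ^ 3 = C.yCoord := by field_simp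
  have hG : (C.yCoord * t⁻¹ ^ 3) ^ 2 =
      aeval t⁻¹ ((quintic c₀ c₁ c₂ c₃ c₄ c₅).map (algebraMap ℚ Qbar)) := by
    rw [mul_pow, C.yCoord_sq, disc, hC]
    simp only [sextic, quintic, Polynomial.map_add, Polynomial.map_mul, Polynomial.map_pow,
      Polynomial.map_sub, map_C, map_X, map_add, map_mul, map_pow, map_sub, aeval_C, aeval_X,
      ← hw'_def, ← ht]
    field_simp
    ring
  refine ⟨hirr, t⁻¹, C.yCoord * t⁻¹ ^ 3, C.isChart, C.isChart.inverse hu hV hG,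
    ⟨?_, Or.inr hw'⟩, hu, hV, hsep.map, ?_⟩
  · rw [hw]
    simp
  · rw [natDegree_map, natDegree_quintic hc]

theorem _root_.IsMumfordPair.map {G a b : ℚ[X]} (h : IsMumfordPair G a b) (K : Type) [Field K]
    [CharZero K] : IsMumfordPair (G.map (algebraMap ℚ K)) (a.map (algebraMap ℚ K))
      (b.map (algebraMap ℚ K)) where
  ne_zero := (Polynomial.map_ne_zero_iff (algebraMap ℚ K).injective).2 h.ne_zero
  dvd := by
    have := Polynomial.map_dvd (algebraMap ℚ K) h.dvd
    rwa [Polynomial.map_sub, Polynomial.map_pow] at this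
  coprime := h.coprime.map (Polynomial.mapRingHom (algebraMap ℚ K))

theorem IsTorsionCertificate.nsmul_mem [Fact (Irreducible C.poly)] {g : Qbar[X]} {G : ℚ[X]}
    {w : Qbar} {x y u V : C.FunctionField}
    (h : IsModel g (G.map (algebraMap ℚ Qbar)) w x y u V) {n : ℕ} {a b A B : ℚ[X]}
    (hcert : IsTorsionCertificate G n a b A B) :
    n • h.mumfordDivisor (a.map (algebraMap ℚ Qbar)) (b.map (algebraMap ℚ Qbar)) ∈
      principalDivisors Qbar C.FunctionField := by
  obtain ⟨c, hc, hnorm⟩ := hcert.norm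
  have hnorm' := congrArg (Polynomial.map (algebraMap ℚ Qbar)) hnorm
  have hdvd := Polynomial.map_dvd (algebraMap ℚ Qbar) hcert.dvd
  simp only [Polynomial.map_sub, Polynomial.map_pow, Polynomial.map_mul, map_C,
    Polynomial.map_add] at hnorm' hdvd
  exact h.nsmul_mumfordDivisor_mem_principalDivisors (hcert.pair.map Qbar)
    (by simpa using hc) hnorm' hdvd (hcert.coprime.map (Polynomial.mapRingHom (algebraMap ℚ Qbar)))

/-- With deg a ≤ 2 and m ≤ 2 the pole order m deg a stays at most 4, below that of V. -/
theorem IsTorsionCertificate.nsmul_notMem [Fact (Irreducible C.poly)] {g : Qbar[X]} {G : ℚ[X]}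
    {w : Qbar} {x y u V : C.FunctionField}
    (h : IsModel g (G.map (algebraMap ℚ Qbar)) w x y u V) {n : ℕ} {a b A B : ℚ[X]}
    (hcert : IsTorsionCertificate G n a b A B) {m : ℕ} (hm : m ≠ 0) (hm2 : m ≤ 2) :
    m • h.mumfordDivisor (a.map (algebraMap ℚ Qbar)) (b.map (algebraMap ℚ Qbar)) ∉
      principalDivisors Qbar C.FunctionField := by
  refine h.nsmul_mumfordDivisor_notMem_principalDivisors (hcert.pair.map Qbar) hm ?_ ?_
  · rw [natDegree_map]
    exact hcert.natDegree_ne_zero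
  · rw [natDegree_map]
    exact Nat.mul_le_mul hm2 hcert.natDegree_le

theorem map_algebraMap_galois (p : ℚ[X]) (σ : Qbar ≃ₐ[ℚ] Qbar) :
    (p.map (algebraMap ℚ Qbar)).map (σ.toRingEquiv : Qbar →+* Qbar) =
      p.map (algebraMap ℚ Qbar) := by
  rw [Polynomial.map_map]
  congr 1
  exact σ.toAlgHom.comp_algebraMap

theorem mk_mumfordDivisor_mem_jacobianRationalPoints [Fact (Irreducible C.poly)] {g : Qbar[X]}
    {G : ℚ[X]} {w : ℚ} {u V : C.FunctionField}
    (h : IsModel g (G.map (algebraMap ℚ Qbar)) (algebraMap ℚ Qbar w) C.xCoord C.yCoord u V)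
    {a b : ℚ[X]} (hab : IsMumfordPair G a b) :
    (QuotientAddGroup.mk (h.mumfordDivisor (a.map (algebraMap ℚ Qbar))
      (b.map (algebraMap ℚ Qbar))) : DivisorClassGroup Qbar C.FunctionField) ∈
      C.jacobianRationalPoints := by
  refine ⟨⟨_, h.divisorDegree_mumfordDivisor _ _, rfl⟩, fun σ => ?_⟩
  refine congrArg QuotientAddGroup.mk (h.divisorMap_mumfordDivisor (hab.map Qbar)
    (C.galoisFunctionField_algebraMap σ) (C.galoisFunctionField_xCoord σ)
    (C.galoisFunctionField_yCoord σ) (σ.commutes w) ?_ ?_)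
  · exact map_algebraMap_galois a σ
  · exact map_algebraMap_galois b σ

/-- A genus `2` curve with a rational Weierstrass point and certificates of torsion of order `4`
and `7` has a rational torsion point of order `28`. -/
theorem exists_addOrderOf_eq_of_certificates {w c₀ c₁ c₂ c₃ c₄ c₅ : ℚ} (hc : c₅ ≠ 0)
    (hC : C.h ^ 2 + 4 * C.f = sextic w c₀ c₁ c₂ c₃ c₄ c₅)
    (hsep : (quintic c₀ c₁ c₂ c₃ c₄ c₅).Separable) {a b A B a' b' A' B' : ℚ[X]}
    (h₄ : IsTorsionCertificate (quintic c₀ c₁ c₂ c₃ c₄ c₅) 4 a b A B)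
    (h₇ : IsTorsionCertificate (quintic c₀ c₁ c₂ c₃ c₄ c₅) 7 a' b' A' B') :
    C.IsGeometricallyIrreducible ∧ C.genus = 2 ∧
      ∃ P : C.jacobianRationalPoints, addOrderOf P = 28 := by
  obtain ⟨hirr, u, V, h⟩ := exists_isModel hc hC hsep
  refine ⟨Field.toIsField C.FunctionField, h.curveGenus_eq_two, ?_⟩
  set α : DivisorClassGroup Qbar C.FunctionField := QuotientAddGroup.mk
    (h.mumfordDivisor (a.map (algebraMap ℚ Qbar)) (b.map (algebraMap ℚ Qbar)))
  set β : DivisorClassGroup Qbar C.FunctionField := QuotientAddGroup.mk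
    (h.mumfordDivisor (a'.map (algebraMap ℚ Qbar)) (b'.map (algebraMap ℚ Qbar)))
  -- For the prime power 2² it is enough that 4α = 0 and 2α ≠ 0; for the prime 7 below, that 7β = 0
  -- and β ≠ 0.
  have hα : addOrderOf α = 4 := by
    have : Fact (Nat.Prime 2) := ⟨Nat.prime_two⟩
    refine addOrderOf_eq_prime_pow (p := 2) (n := 1) ?_ ?_
    · exact fun h0 => h₄.nsmul_notMem h two_ne_zero le_rfl ((QuotientAddGroup.eq_zero_iff _).1 h0)
    · exact (QuotientAddGroup.eq_zero_iff _).2 (h₄.nsmul_mem h)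
  have hβ : addOrderOf β = 7 := by
    have : Fact (Nat.Prime 7) := ⟨by norm_num⟩
    refine addOrderOf_eq_prime ?_ ?_
    · exact (QuotientAddGroup.eq_zero_iff _).2 (h₇.nsmul_mem h)
    · intro h0
      have := h₇.nsmul_notMem h one_ne_zero one_le_two
      rw [one_smul] at this
      exact this ((QuotientAddGroup.eq_zero_iff _).1 h0)
  refine ⟨⟨α + β, add_mem (mk_mumfordDivisor_mem_jacobianRationalPoints h h₄.pair)
    (mk_mumfordDivisor_mem_jacobianRationalPoints h h₇.pair)⟩, ?_⟩
  rw [AddSubgroup.addOrderOf_mk,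
    (AddCommute.all α β).addOrderOf_add_eq_mul_addOrderOf_of_coprime (by rw [hα, hβ]; norm_num),
    hα, hβ]

end Torsion

end HyperellipticEquation

/-! ## The five curves -/

set_option linter.unusedSimpArgs false

namespace HyperellipticEquation

/-- Cofactors q, q' for the divisibilities and Bézout coefficients for the coprimalities reduce a
certificate to polynomial identities over ℚ. -/
theorem IsTorsionCertificate.of_identities {G a b A B q s t q' s' t' : ℚ[X]} {n : ℕ} {c : ℚ}
    (h0 : a.natDegree ≠ 0) (h2 : a.natDegree ≤ 2) (hc : c ≠ 0) (hq : G - b ^ 2 = a * q)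
    (hst : s * a + t * G = 1) (hnorm : A ^ 2 - B ^ 2 * G = C c * a ^ n)
    (hq' : A + B * b = a * q') (hst' : s' * a + t' * B = 1) :
    IsTorsionCertificate G n a b A B where
  natDegree_ne_zero := h0
  natDegree_le := h2
  pair := ⟨fun h => h0 (by rw [h, natDegree_zero]), ⟨q, hq⟩, ⟨s, t, hst⟩⟩
  norm := ⟨c, hc, hnorm⟩
  dvd := ⟨q', hq'⟩
  coprime := ⟨s', t', hst'⟩

theorem natDegree_X_sq_add (p q : ℚ) : (X ^ 2 + C p * X + C q : ℚ[X]).natDegree = 2 := by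
  compute_degree!

theorem separable_quintic_of_identity {c₀ c₁ c₂ c₃ c₄ c₅ : ℚ} {s t : ℚ[X]}
    (h : s * quintic c₀ c₁ c₂ c₃ c₄ c₅ + t * (C (5 * c₅) * X ^ 4 + C (4 * c₄) * X ^ 3 +
      C (3 * c₃) * X ^ 2 + C (2 * c₂) * X + C c₁) = 1) :
    (quintic c₀ c₁ c₂ c₃ c₄ c₅).Separable := by
  refine ⟨s, t, ?_⟩
  rw [← h]
  congr 2
  refine Polynomial.funext fun z => ?_
  simp [quintic]
  ring

/-! ### The first curve, with Weierstrass point x = 1 -/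

theorem separable_quintic_C28_1 :
    (quintic 4 36 141 286 297 104).Separable :=
  separable_quintic_of_identity
    (s :=
      C (19096625/114688) * X ^ 3 + C (148266405/425984) * X ^ 2 + C (1180658043/5963776) * X + C
      (108832817/2981888))
    (t :=
      C (-3819325/114688) * X ^ 4 + C (-1057159773/11927552) * X ^ 3 + C (-865112485/11927552) * X
      ^ 2 + C (-20087227/745472) * X + C (-12009705/2981888))
    (Polynomial.funext fun z => by
      simp only [quintic, eval_add, eval_sub, eval_mul, eval_pow, eval_X, eval_C, eval_one, eval_zero]
      ring)

/-- Here A² has degree 8, above the degree 7 of B²G, so c is the square of the leading coefficient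
of A: 456976 = 676². -/
theorem isTorsionCertificate_four_C28_1 :
    IsTorsionCertificate (quintic 4 36 141 286 297 104) 4
      (X ^ 2 + C (23/13) * X + C (6/13))
      (C (-48/13) * X + C (-8/13))
      (C (-676) * X ^ 4 + C (-3029) * X ^ 3 + C (-4161) * X ^ 2 + C (-1888) * X + C (-340))
      (C (91) * X + C (154)) :=
  .of_identities (c := 456976)
    (q :=
      C (104) * X ^ 3 + C (113) * X ^ 2 + C (495/13) * X + C (102/13))
    (s :=
      C (-2028/7) * X ^ 4 + C (-41431/56) * X ^ 3 + C (-254423/448) * X ^ 2 + C (-96525/448) * X +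
      C (-7449/224))
    (t :=
      C (39/14) * X + C (1831/448))
    (q' :=
      C (-676) * X ^ 2 + C (-1833) * X + C (-942))
    (s' :=
      C (169/56))
    (t' :=
      C (-13/392) * X + C (-1/392))
    (by rw [natDegree_X_sq_add]; norm_num) (natDegree_X_sq_add _ _).le (by norm_num)
    (Polynomial.funext fun z => by
      simp only [quintic, eval_add, eval_sub, eval_mul, eval_pow, eval_X, eval_C, eval_one, eval_zero]
      ring)
    (Polynomial.funext fun z => by
      simp only [quintic, eval_add, eval_sub, eval_mul, eval_pow, eval_X, eval_C, eval_one, eval_zero]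
      ring)
    (Polynomial.funext fun z => by
      simp only [quintic, eval_add, eval_sub, eval_mul, eval_pow, eval_X, eval_C, eval_one, eval_zero]
      ring)
    (Polynomial.funext fun z => by
      simp only [quintic, eval_add, eval_sub, eval_mul, eval_pow, eval_X, eval_C, eval_one, eval_zero]
      ring)
    (Polynomial.funext fun z => by
      simp only [quintic, eval_add, eval_sub, eval_mul, eval_pow, eval_X, eval_C, eval_one, eval_zero]
      ring)

/-- The divisor consists of two rational points, over u = 0 (that is, x = ∞) and u = -1 (that is, x
= 0). -/
theorem isTorsionCertificate_seven_C28_1 :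
    IsTorsionCertificate (quintic 4 36 141 286 297 104) 7
      (X ^ 2 + C (1) * X + C (0))
      (C (2) * X + C (-2))
      (C (-2) * X ^ 7 + C (-33) * X ^ 6 + C (-135) * X ^ 5 + C (-226) * X ^ 4 + C (-181) * X ^ 3 +
      C (-80) * X ^ 2 + C (-19) * X + C (-2))
      (C (-1) * X ^ 4 + C (-6) * X ^ 3 + C (-10) * X ^ 2 + C (-5) * X + C (-1)) :=
  .of_identities (c := 4)
    (q :=
      C (104) * X ^ 3 + C (193) * X ^ 2 + C (93) * X + C (44))
    (s :=
      C (-39/2) * X ^ 4 + C (-995/16) * X ^ 3 + C (-1051/16) * X ^ 2 + C (-129/4) * X + C (-39/4))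
    (t :=
      C (3/16) * X + C (1/4))
    (q' :=
      C (-2) * X ^ 5 + C (-31) * X ^ 4 + C (-106) * X ^ 3 + C (-130) * X ^ 2 + C (-59) * X + C
      (-11))
    (s' :=
      C (-1) * X ^ 2 + C (-5) * X + C (-5))
    (t' :=
      C (-1))
    (by rw [natDegree_X_sq_add]; norm_num) (natDegree_X_sq_add _ _).le (by norm_num)
    (Polynomial.funext fun z => by
      simp only [quintic, eval_add, eval_sub, eval_mul, eval_pow, eval_X, eval_C, eval_one, eval_zero]
      ring)
    (Polynomial.funext fun z => by
      simp only [quintic, eval_add, eval_sub, eval_mul, eval_pow, eval_X, eval_C, eval_one, eval_zero]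
      ring)
    (Polynomial.funext fun z => by
      simp only [quintic, eval_add, eval_sub, eval_mul, eval_pow, eval_X, eval_C, eval_one, eval_zero]
      ring)
    (Polynomial.funext fun z => by
      simp only [quintic, eval_add, eval_sub, eval_mul, eval_pow, eval_X, eval_C, eval_one, eval_zero]
      ring)
    (Polynomial.funext fun z => by
      simp only [quintic, eval_add, eval_sub, eval_mul, eval_pow, eval_X, eval_C, eval_one, eval_zero]
      ring)

theorem h_sq_add_four_mul_f_C28_1 :
    C28_1.h ^ 2 + 4 * C28_1.f = sextic 1 4 36 141 286 297 104 :=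
  Polynomial.funext fun z => by
    simp only [C28_1, sextic, eval_add, eval_sub, eval_mul, eval_pow, eval_X, eval_C, eval_ofNat]
    ring

/-! ### The second curve, with Weierstrass point x = 0 -/

theorem separable_quintic_C28_2 :
    (quintic 4 12 13 54 (-23) 72).Separable :=
  separable_quintic_of_identity
    (s :=
      C (-42235/351232) * X ^ 3 + C (3526261/6322176) * X ^ 2 + C (-6257219/12644352) * X + C
      (938897/4214784))
    (t :=
      C (8447/351232) * X ^ 4 + C (-2859865/25288704) * X ^ 3 + C (713911/6322176) * X ^ 2 + C
      (-1959365/25288704) * X + C (114799/12644352))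
    (Polynomial.funext fun z => by
      simp only [quintic, eval_add, eval_sub, eval_mul, eval_pow, eval_X, eval_C, eval_one, eval_zero]
      ring)

theorem isTorsionCertificate_four_C28_2 :
    IsTorsionCertificate (quintic 4 12 13 54 (-23) 72) 4
      (X ^ 2 + C (5/9) * X + C (2/9))
      (C (2/3) * X + C (8/3))
      (C (-324) * X ^ 4 + C (-441) * X ^ 3 + C (-208) * X ^ 2 + C (-125) * X + C (-34))
      (C (27) * X + C (15)) :=
  .of_identities (c := 104976)
    (q :=
      C (72) * X ^ 3 + C (-63) * X ^ 2 + C (73) * X + C (-14))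
    (s :=
      C (603/98) * X ^ 4 + C (-11765/784) * X ^ 3 + C (2873/196) * X ^ 2 + C (-8557/784) * X + C
      (821/392))
    (t :=
      C (-67/784) * X + C (943/7056))
    (q' :=
      C (-324) * X ^ 2 + C (-261) * X + C (27))
    (s' :=
      C (9/2))
    (t' :=
      C (-1/6) * X)
    (by rw [natDegree_X_sq_add]; norm_num) (natDegree_X_sq_add _ _).le (by norm_num)
    (Polynomial.funext fun z => by
      simp only [quintic, eval_add, eval_sub, eval_mul, eval_pow, eval_X, eval_C, eval_one, eval_zero]
      ring)
    (Polynomial.funext fun z => by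
      simp only [quintic, eval_add, eval_sub, eval_mul, eval_pow, eval_X, eval_C, eval_one, eval_zero]
      ring)
    (Polynomial.funext fun z => by
      simp only [quintic, eval_add, eval_sub, eval_mul, eval_pow, eval_X, eval_C, eval_one, eval_zero]
      ring)
    (Polynomial.funext fun z => by
      simp only [quintic, eval_add, eval_sub, eval_mul, eval_pow, eval_X, eval_C, eval_one, eval_zero]
      ring)
    (Polynomial.funext fun z => by
      simp only [quintic, eval_add, eval_sub, eval_mul, eval_pow, eval_X, eval_C, eval_one, eval_zero]
      ring)

/-- A single point suffices: u = 0, V = 2 is one of the two points over x = ∞. The norm has odd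
degree 7, so B²G dominates and c = -(-2)²·72. -/
theorem isTorsionCertificate_seven_C28_2 :
    IsTorsionCertificate (quintic 4 12 13 54 (-23) 72) 7
      (X)
      (C (2))
      (C (14) * X ^ 3 + C (7) * X ^ 2 + C (7) * X + C (2))
      (C (-2) * X + C (-1)) :=
  .of_identities (c := -288)
    (q :=
      C (72) * X ^ 4 + C (-23) * X ^ 3 + C (54) * X ^ 2 + C (13) * X + C (12))
    (s :=
      C (-18) * X ^ 4 + C (23/4) * X ^ 3 + C (-27/2) * X ^ 2 + C (-13/4) * X + C (-3))
    (t :=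
      C (1/4))
    (q' :=
      C (14) * X ^ 2 + C (7) * X + C (3))
    (s' :=
      C (-2))
    (t' :=
      C (-1))
    (by simp) (by simp) (by norm_num)
    (Polynomial.funext fun z => by
      simp only [quintic, eval_add, eval_sub, eval_mul, eval_pow, eval_X, eval_C, eval_one, eval_zero]
      ring)
    (Polynomial.funext fun z => by
      simp only [quintic, eval_add, eval_sub, eval_mul, eval_pow, eval_X, eval_C, eval_one, eval_zero]
      ring)
    (Polynomial.funext fun z => by
      simp only [quintic, eval_add, eval_sub, eval_mul, eval_pow, eval_X, eval_C, eval_one, eval_zero]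
      ring)
    (Polynomial.funext fun z => by
      simp only [quintic, eval_add, eval_sub, eval_mul, eval_pow, eval_X, eval_C, eval_one, eval_zero]
      ring)
    (Polynomial.funext fun z => by
      simp only [quintic, eval_add, eval_sub, eval_mul, eval_pow, eval_X, eval_C, eval_one, eval_zero]
      ring)

theorem h_sq_add_four_mul_f_C28_2 :
    C28_2.h ^ 2 + 4 * C28_2.f = sextic 0 4 12 13 54 (-23) 72 :=
  Polynomial.funext fun z => by
    simp only [C28_2, sextic, eval_add, eval_sub, eval_mul, eval_pow, eval_X, eval_C, eval_ofNat]
    ring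

/-! ### The third curve, with Weierstrass point x = -1 -/

theorem separable_quintic_C28_3 :
    (quintic 16 (-104) 353 (-678) 769 (-400)).Separable :=
  separable_quintic_of_identity
    (s :=
      C (-3197045/43904) * X ^ 3 + C (461911521/4390400) * X ^ 2 + C (-444408609/8780800) * X + C
      (74041869/8780800))
    (t :=
      C (639409/43904) * X ^ 4 + C (-467870321/17561600) * X ^ 3 + C (34200653/1756160) * X ^ 2 +
      C (-131315657/17561600) * X + C (5653313/4390400))
    (Polynomial.funext fun z => by
      simp only [quintic, eval_add, eval_sub, eval_mul, eval_pow, eval_X, eval_C, eval_one, eval_zero]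
      ring)

theorem isTorsionCertificate_four_C28_3 :
    IsTorsionCertificate (quintic 16 (-104) 353 (-678) 769 (-400)) 4
      (X ^ 2 + C (-1/2) * X + C (0))
      (C (9/2) * X + C (-4))
      (C (-8) * X ^ 4 + C (33) * X ^ 3 + C (-36) * X ^ 2 + C (17) * X + C (-4))
      (X + C (-1)) :=
  .of_identities (c := 64)
    (q :=
      C (-400) * X ^ 3 + C (569) * X ^ 2 + C (-787/2) * X + C (136))
    (s :=
      C (10350/49) * X ^ 4 + C (-107983/392) * X ^ 3 + C (33757/196) * X ^ 2 + C (-22703/392) * X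
      + C (191/49))
    (t :=
      C (207/392) * X + C (1/16))
    (q' :=
      C (-8) * X ^ 2 + C (29) * X + C (-17))
    (s' :=
      C (2))
    (t' :=
      C (-2) * X + C (-1))
    (by rw [natDegree_X_sq_add]; norm_num) (natDegree_X_sq_add _ _).le (by norm_num)
    (Polynomial.funext fun z => by
      simp only [quintic, eval_add, eval_sub, eval_mul, eval_pow, eval_X, eval_C, eval_one, eval_zero]
      ring)
    (Polynomial.funext fun z => by
      simp only [quintic, eval_add, eval_sub, eval_mul, eval_pow, eval_X, eval_C, eval_one, eval_zero]
      ring)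
    (Polynomial.funext fun z => by
      simp only [quintic, eval_add, eval_sub, eval_mul, eval_pow, eval_X, eval_C, eval_one, eval_zero]
      ring)
    (Polynomial.funext fun z => by
      simp only [quintic, eval_add, eval_sub, eval_mul, eval_pow, eval_X, eval_C, eval_one, eval_zero]
      ring)
    (Polynomial.funext fun z => by
      simp only [quintic, eval_add, eval_sub, eval_mul, eval_pow, eval_X, eval_C, eval_one, eval_zero]
      ring)

theorem isTorsionCertificate_seven_C28_3 :
    IsTorsionCertificate (quintic 16 (-104) 353 (-678) 769 (-400)) 7
      (X)
      (C (4))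
      (C (63) * X ^ 3 + C (-105) * X ^ 2 + C (56) * X + C (-16))
      (C (-1) * X + C (4)) :=
  .of_identities (c := 400)
    (q :=
      C (-400) * X ^ 4 + C (769) * X ^ 3 + C (-678) * X ^ 2 + C (353) * X + C (-104))
    (s :=
      C (25) * X ^ 4 + C (-769/16) * X ^ 3 + C (339/8) * X ^ 2 + C (-353/16) * X + C (13/2))
    (t :=
      C (1/16))
    (q' :=
      C (63) * X ^ 2 + C (-105) * X + C (52))
    (s' :=
      C (1/4))
    (t' :=
      C (1/4))
    (by simp) (by simp) (by norm_num)
    (Polynomial.funext fun z => by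
      simp only [quintic, eval_add, eval_sub, eval_mul, eval_pow, eval_X, eval_C, eval_one, eval_zero]
      ring)
    (Polynomial.funext fun z => by
      simp only [quintic, eval_add, eval_sub, eval_mul, eval_pow, eval_X, eval_C, eval_one, eval_zero]
      ring)
    (Polynomial.funext fun z => by
      simp only [quintic, eval_add, eval_sub, eval_mul, eval_pow, eval_X, eval_C, eval_one, eval_zero]
      ring)
    (Polynomial.funext fun z => by
      simp only [quintic, eval_add, eval_sub, eval_mul, eval_pow, eval_X, eval_C, eval_one, eval_zero]
      ring)
    (Polynomial.funext fun z => by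
      simp only [quintic, eval_add, eval_sub, eval_mul, eval_pow, eval_X, eval_C, eval_one, eval_zero]
      ring)

theorem h_sq_add_four_mul_f_C28_3 :
    C28_3.h ^ 2 + 4 * C28_3.f = sextic (-1) 16 (-104) 353 (-678) 769 (-400) :=
  Polynomial.funext fun z => by
    simp only [C28_3, sextic, eval_add, eval_sub, eval_mul, eval_pow, eval_X, eval_C, eval_ofNat]
    ring

/-! ### The fourth curve, with Weierstrass point x = -23/7 -/

theorem separable_quintic_C28_4 :
    (quintic 113283072 (-1564891008) (57527624575/7) (-959230634546/49) (6274748884399/343) (-2948298278112/2401)).Separable :=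
  separable_quintic_of_identity
    (s :=
      C (-2406413347243548061391825/1045511238434918830750715904) * X ^ 3 + C
      (15313822518179966524015479480355/571232689451222948955229146218496) * X ^ 2 + C
      (-352375741535881521246827107253267/23882966730389226151556723351420928) * X + C
      (22108332286129329512737131944245/10235557170166811207810024293466112))
    (t :=
      C (481282669448709612278365/1045511238434918830750715904) * X ^ 4 + C
      (-15385047453374057454966430747171/2284930757804891795820916584873984) * X ^ 3 + C
      (35921002418909349923734147559033/6513536381015243495879106368569344) * X ^ 2 + C
      (-32461835039920782416762055129589/20471114340333622415620048586932224) * X + C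
      (2381583747960710165405194903/15231483884176802392574440912896))
    (Polynomial.funext fun z => by
      simp only [quintic, eval_add, eval_sub, eval_mul, eval_pow, eval_X, eval_C, eval_one, eval_zero]
      ring)

theorem isTorsionCertificate_four_C28_4 :
    IsTorsionCertificate (quintic 113283072 (-1564891008) (57527624575/7) (-959230634546/49) (6274748884399/343) (-2948298278112/2401)) 4
      (X ^ 2 + C (-2230445/159357) * X + C (198548/53119))
      (C (3512992/33) * X + C (-317716/11))
      (C (-406314455184) * X ^ 4 + C (11540589373159) * X ^ 3 + C (-85026816022974) * X ^ 2 + C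
      (43853622635431) * X + C (-5883221854272))
      (C (-10500259) * X + C (145181267)) :=
  .of_identities (c := 165091436491470744473856)
    (q :=
      C (-2948298278112/2401) * X ^ 3 + C (379613924239/343) * X ^ 2 + C (74129414885/147) * X + C
      (-1350186644/7))
    (s :=
      C (-7246839869581664/955048816869) * X ^ 4 + C (59822933635662290707/539056839349917) * X ^
      3 + C (-49083537153973205773637/540905034227688144) * X ^ 2 + C
      (87584264496478836773/3359658597687504) * X + C (-2364166618682159059/919906520795388))
    (t :=
      C (-1871601205987/302879221971881499) * X + C (9356055052626423929/110322112401767131511184))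
    (q' :=
      C (-406314455184) * X ^ 2 + C (5853596991319) * X + C (-2695848371447))
    (s' :=
      C (159357/220892))
    (t' :=
      C (1317/19168786868) * X + C (-8/684599531))
    (by rw [natDegree_X_sq_add]; norm_num) (natDegree_X_sq_add _ _).le (by norm_num)
    (Polynomial.funext fun z => by
      simp only [quintic, eval_add, eval_sub, eval_mul, eval_pow, eval_X, eval_C, eval_one, eval_zero]
      ring)
    (Polynomial.funext fun z => by
      simp only [quintic, eval_add, eval_sub, eval_mul, eval_pow, eval_X, eval_C, eval_one, eval_zero]
      ring)
    (Polynomial.funext fun z => by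
      simp only [quintic, eval_add, eval_sub, eval_mul, eval_pow, eval_X, eval_C, eval_one, eval_zero]
      ring)
    (Polynomial.funext fun z => by
      simp only [quintic, eval_add, eval_sub, eval_mul, eval_pow, eval_X, eval_C, eval_one, eval_zero]
      ring)
    (Polynomial.funext fun z => by
      simp only [quintic, eval_add, eval_sub, eval_mul, eval_pow, eval_X, eval_C, eval_one, eval_zero]
      ring)

theorem isTorsionCertificate_seven_C28_4 :
    IsTorsionCertificate (quintic 113283072 (-1564891008) (57527624575/7) (-959230634546/49) (6274748884399/343) (-2948298278112/2401)) 7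
      (X ^ 2 + C (-211183/35559) * X + C (12544/11853))
      (C (129671864/243) * X + C (-7824320/81))
      (C (-128971059545766452454) * X ^ 7 + C (19719778759574666284197) * X ^ 6 + C
      (-594457590045211707741003) * X ^ 5 + C (5227532015191285419305343) * X ^ 4 + C
      (-5615984135375741068628659) * X ^ 3 + C (2415152871879018352129216) * X ^ 2 + C
      (-473092361912744322846720) * X + C (35284246168913281548288))
      (C (-59826399280707969) * X ^ 4 + C (3159966119953201650) * X ^ 3 + C (-36880765360756149105)
      * X ^ 2 + C (21551056447959036544) * X + C (-3315080058453037056)) :=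
  .of_identities (c := 16633534200357635977192078196224242622116)
    (q :=
      C (-2948298278112/2401) * X ^ 3 + C (33960158144263/3087) * X ^ 2 + C
      (1680954691453735/35721) * X + C (-14815449713536/1701))
    (s :=
      C (-1817804171638771371/19369829499972224) * X ^ 4 + C
      (53677531380773653880725/38872480687944257536) * X ^ 3 + C
      (-1514158878510507213842629/1218929930143394932736) * X ^ 2 + C
      (139185785181921791777491/348265694326684266496) * X + C
      (-17932747170197522337/388689390989602976))
    (t :=
      C (-1669241663580139/21841234258487770427392) * X + C
      (48800067145909329139/110950349856795232661090304))
    (q' :=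
      C (-128971059545766452454) * X ^ 5 + C (18953826531782726220399) * X ^ 4 + C
      (-513680443613146128187260) * X ^ 3 + C (3848781340407476446449651) * X ^ 2 + C
      (-6601623351778637028000896/3) * X + C (335925888382699552157696))
    (s' :=
      C (2152652034867720683265/116309460193572642820096) * X ^ 3 + C
      (-8094089372090025829599/8307818585255188772864) * X ^ 2 + C
      (11707620211006315626117303/1042037816836293677510656) * X + C
      (-5393538511240862469771/1162988634861934907936))
    (t' :=
      C (70434098685/227675884638378641892980740096) * X + C
      (-229020179635277/128506774315176287731309557731328))
    (by rw [natDegree_X_sq_add]; norm_num) (natDegree_X_sq_add _ _).le (by norm_num)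
    (Polynomial.funext fun z => by
      simp only [quintic, eval_add, eval_sub, eval_mul, eval_pow, eval_X, eval_C, eval_one, eval_zero]
      ring)
    (Polynomial.funext fun z => by
      simp only [quintic, eval_add, eval_sub, eval_mul, eval_pow, eval_X, eval_C, eval_one, eval_zero]
      ring)
    (Polynomial.funext fun z => by
      simp only [quintic, eval_add, eval_sub, eval_mul, eval_pow, eval_X, eval_C, eval_one, eval_zero]
      ring)
    (Polynomial.funext fun z => by
      simp only [quintic, eval_add, eval_sub, eval_mul, eval_pow, eval_X, eval_C, eval_one, eval_zero]
      ring)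
    (Polynomial.funext fun z => by
      simp only [quintic, eval_add, eval_sub, eval_mul, eval_pow, eval_X, eval_C, eval_one, eval_zero]
      ring)

theorem h_sq_add_four_mul_f_C28_4 :
    C28_4.h ^ 2 + 4 * C28_4.f = sextic (-23/7) 113283072 (-1564891008) (57527624575/7) (-959230634546/49) (6274748884399/343) (-2948298278112/2401) :=
  Polynomial.funext fun z => by
    simp only [C28_4, sextic, eval_add, eval_sub, eval_mul, eval_pow, eval_X, eval_C, eval_ofNat]
    ring

/-! ### The fifth curve, with Weierstrass point x = 0 -/

theorem separable_quintic_C28_5 :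
    (quintic 100 (-1820) 6701 9978 2281 (-4840)).Separable :=
  separable_quintic_of_identity
    (s :=
      C (12096776715381361/56068336400000000) * X ^ 3 + C
      (-459602799376241487/7888684540000000000) * X ^ 2 + C
      (-185209186758908819307/678426870440000000000) * X + C
      (-100796935652003763531/678426870440000000000))
    (t :=
      C (-12096776715381361/280341682000000000) * X ^ 4 + C
      (21328885836099684041/1356853740880000000000) * X ^ 3 + C
      (30738684433776233917/339213435220000000000) * X ^ 2 + C
      (94186310581526106341/1356853740880000000000) * X + C
      (-1182211036883557841/135685374088000000000))
    (Polynomial.funext fun z => by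
      simp only [quintic, eval_add, eval_sub, eval_mul, eval_pow, eval_X, eval_C, eval_one, eval_zero]
      ring)

theorem isTorsionCertificate_four_C28_5 :
    IsTorsionCertificate (quintic 100 (-1820) 6701 9978 2281 (-4840)) 4
      (X ^ 2 + C (1519/121) * X + C (-390/121))
      (C (-34830/11) * X + C (8600/11))
      (C (-292820) * X ^ 4 + C (17259561) * X ^ 3 + C (-6020232) * X ^ 2 + C (44239901) * X + C
      (-5076010))
      (C (-54571) * X + C (406351)) :=
  .of_identities (c := 85743552400)
    (q :=
      C (-4840) * X ^ 3 + C (63041) * X ^ 2 + C (-797021) * X + C (189610))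
    (s :=
      C (30569319/18952250) * X ^ 4 + C (-268493959/758090000) * X ^ 3 + C (-647110183/189522500)
      * X ^ 2 + C (-2344086959/758090000) * X + C (-13482971/75809000))
    (t :=
      C (252639/758090000) * X + C (391453031/91728890000))
    (q' :=
      C (-292820) * X ^ 2 + C (20935541) * X + C (-96991301))
    (s' :=
      C (121/17630))
    (t' :=
      C (1/7951130) * X + C (2/795113))
    (by rw [natDegree_X_sq_add]; norm_num) (natDegree_X_sq_add _ _).le (by norm_num)
    (Polynomial.funext fun z => by
      simp only [quintic, eval_add, eval_sub, eval_mul, eval_pow, eval_X, eval_C, eval_one, eval_zero]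
      ring)
    (Polynomial.funext fun z => by
      simp only [quintic, eval_add, eval_sub, eval_mul, eval_pow, eval_X, eval_C, eval_one, eval_zero]
      ring)
    (Polynomial.funext fun z => by
      simp only [quintic, eval_add, eval_sub, eval_mul, eval_pow, eval_X, eval_C, eval_one, eval_zero]
      ring)
    (Polynomial.funext fun z => by
      simp only [quintic, eval_add, eval_sub, eval_mul, eval_pow, eval_X, eval_C, eval_one, eval_zero]
      ring)
    (Polynomial.funext fun z => by
      simp only [quintic, eval_add, eval_sub, eval_mul, eval_pow, eval_X, eval_C, eval_one, eval_zero]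
      ring)

theorem isTorsionCertificate_seven_C28_5 :
    IsTorsionCertificate (quintic 100 (-1820) 6701 9978 2281 (-4840)) 7
      (X)
      (C (10))
      (C (-570) * X ^ 3 + C (-831) * X ^ 2 + C (191) * X + C (-10))
      (C (-10) * X + C (1)) :=
  .of_identities (c := 484000)
    (q :=
      C (-4840) * X ^ 4 + C (2281) * X ^ 3 + C (9978) * X ^ 2 + C (6701) * X + C (-1820))
    (s :=
      C (242/5) * X ^ 4 + C (-2281/100) * X ^ 3 + C (-4989/50) * X ^ 2 + C (-6701/100) * X + C
      (91/5))
    (t :=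
      C (1/100))
    (q' :=
      C (-570) * X ^ 2 + C (-831) * X + C (91))
    (s' :=
      C (10))
    (t' :=
      C (1))
    (by simp) (by simp) (by norm_num)
    (Polynomial.funext fun z => by
      simp only [quintic, eval_add, eval_sub, eval_mul, eval_pow, eval_X, eval_C, eval_one, eval_zero]
      ring)
    (Polynomial.funext fun z => by
      simp only [quintic, eval_add, eval_sub, eval_mul, eval_pow, eval_X, eval_C, eval_one, eval_zero]
      ring)
    (Polynomial.funext fun z => by
      simp only [quintic, eval_add, eval_sub, eval_mul, eval_pow, eval_X, eval_C, eval_one, eval_zero]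
      ring)
    (Polynomial.funext fun z => by
      simp only [quintic, eval_add, eval_sub, eval_mul, eval_pow, eval_X, eval_C, eval_one, eval_zero]
      ring)
    (Polynomial.funext fun z => by
      simp only [quintic, eval_add, eval_sub, eval_mul, eval_pow, eval_X, eval_C, eval_one, eval_zero]
      ring)

theorem h_sq_add_four_mul_f_C28_5 :
    C28_5.h ^ 2 + 4 * C28_5.f = sextic 0 100 (-1820) 6701 9978 2281 (-4840) :=
  Polynomial.funext fun z => by
    simp only [C28_5, sextic, eval_add, eval_sub, eval_mul, eval_pow, eval_X, eval_C, eval_ofNat]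
    ring

end HyperellipticEquation

end

/-- Each of the five curves is a (geometrically irreducible, smooth projective) curve of genus `2`
over `ℚ` whose Jacobian has a rational torsion point of order `28`. -/
theorem theoremT :
    ∀ C ∈ ({C28_1, C28_2, C28_3, C28_4, C28_5} : Set HyperellipticEquation),
      C.IsGeometricallyIrreducible ∧ C.genus = 2 ∧
        ∃ P : C.jacobianRationalPoints, addOrderOf P = 28 := by
  rintro C (rfl | rfl | rfl | rfl | rfl)
  · exact HyperellipticEquation.exists_addOrderOf_eq_of_certificates (by norm_num)
      HyperellipticEquation.h_sq_add_four_mul_f_C28_1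
      HyperellipticEquation.separable_quintic_C28_1
      HyperellipticEquation.isTorsionCertificate_four_C28_1
      HyperellipticEquation.isTorsionCertificate_seven_C28_1
  · exact HyperellipticEquation.exists_addOrderOf_eq_of_certificates (by norm_num)
      HyperellipticEquation.h_sq_add_four_mul_f_C28_2
      HyperellipticEquation.separable_quintic_C28_2
      HyperellipticEquation.isTorsionCertificate_four_C28_2
      HyperellipticEquation.isTorsionCertificate_seven_C28_2
  · exact HyperellipticEquation.exists_addOrderOf_eq_of_certificates (by norm_num)
      HyperellipticEquation.h_sq_add_four_mul_f_C28_3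
      HyperellipticEquation.separable_quintic_C28_3
      HyperellipticEquation.isTorsionCertificate_four_C28_3
      HyperellipticEquation.isTorsionCertificate_seven_C28_3
  · exact HyperellipticEquation.exists_addOrderOf_eq_of_certificates (by norm_num)
      HyperellipticEquation.h_sq_add_four_mul_f_C28_4
      HyperellipticEquation.separable_quintic_C28_4
      HyperellipticEquation.isTorsionCertificate_four_C28_4
      HyperellipticEquation.isTorsionCertificate_seven_C28_4
  · exact HyperellipticEquation.exists_addOrderOf_eq_of_certificates (by norm_num)
      HyperellipticEquation.h_sq_add_four_mul_f_C28_5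
      HyperellipticEquation.separable_quintic_C28_5
      HyperellipticEquation.isTorsionCertificate_four_C28_5
      HyperellipticEquation.isTorsionCertificate_seven_C28_5
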